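/- Let $K$ be a number field with algebraic closure $\bar K$, and let $f\in K(x)$ be a nonconstant rational function, viewed as a self-map of $\mathbb P^1(\bar K)=\bar K\cup\{\infty\}$. Assume that $f$ is post-critically finite, i.e. every critical point $c\in\mathbb P^1(\bar K)$ has a finite forward orbit. Let $\mathfrak p$ be a prime of $K$ at which $f$ has good reduction $\tilde f$ (we can write $f=P/Q$ with $P,Q$ integral at $\mathfrak p$, whose reductions are coprime and have quotient $\tilde f$ of degree $\deg f$), and fix a place of $\bar K$ above $\mathfrak p$, with residue field $k$ of characteristic $p$; "modulo $\mathfrak p$", "$\mathfrak p$ divides" and "ramified at $\mathfrak p$" refer to this place. Denote by $x\mapsto\tilde x$ the reduction $\mathbb P^1(\bar K)\to\mathbb P^1(k)$. Assume that $f$ has height zero at $\mathfrak p$, i.e. $h=0$ is the largest integer $h\ge 0$ such that $\tilde f(x)=R(x^{p^h})$ for some rational function $R\in k(x)$. For $\alpha\in\mathbb P^1(\bar K)$ the arboreal representation with base point $\alpha$ is the action of $\mathrm{Gal}(\bar K/K(\alpha))$ on the rooted tree of iterated preimages of $\alpha$ under $f$ (for $\alpha\in\mathbb P^1(K)$ this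 is a representation of $\mathrm{Gal}(\bar K/K)$). It is infinitely ramified at $\mathfrak p$ if there is no finite extension $E$ of $K(\alpha)$ such that its restriction to $\mathrm{Gal}(\bar K/E)$ is trivial on the inertia group of the fixed place. Let $\Delta_f=\{c-f^n(c) : c\in\mathbb P^1(\bar K)\text{ a critical point of } f,\ n\ge 1\}$, where differences $x-y$ of points of $\mathbb P^1(\bar K)$ are formal (pairs $(x,y)$), and $\mathfrak p$ is said to divide $x-y$ if $x$ and $y$ have the same reduction: for finite $x,y$, if $x-y$ lies in the maximal ideal of the place or both $1/x$ and $1/y$ do; $\mathfrak p$ divides $x-\infty$ if $1/x$ lies in the maximal ideal; and $\mathfrak p$ divides $\infty-\infty$. Then: 1. $\Delta_f$ is finite. 2. There is an $\alpha\in\bar K$ such that the arboreal representation with base point $\alpha$ is infinitely ramified at $\mathfrak p$ if and only if $\mathfrak p$ divides a member of $\Delta_f$. If all critical points of $f$ lie in $\mathbb P^1(K)$, the same equivalence holds with $\alpha\in K$ in place of $\alpha\in\bar K$. 3. More precisely, let $\alpha\in\mathbb P^1(\bar K)$ (for example $\alpha\in K$). If the arboreal representation with base point $\alpha$ is infinitely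 ramified at $\mathfrak p$, then there is a critical point $c$ of $f$ such that $\tilde c$ is periodic under $\tilde f$ and $\tilde\alpha$ lies in the forward orbit of $\tilde c$ under $\tilde f$. Conversely, if there is such a critical point $c$ and $\alpha$ is not periodic under $f$, then the arboreal representation with base point $\alpha$ is infinitely ramified at $\mathfrak p$. -/

import Mathlib

noncomputable section

namespace ArborealPCF

open Polynomial

/-! ### Rational maps on the projective line

`OnePoint L` is the set `ℙ¹(L) = L ∪ {∞}`. -/

section RationalMaps

variable {F : Type*} [Field F]

/-- The degree of the rational map `f = P / Q` (in lowest terms), `max (deg P) (deg Q)`. -/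
def degree (f : RatFunc F) : ℕ := max f.num.natDegree f.denom.natDegree

/-- The self-map of `ℙ¹(L)` induced by a rational function with coefficients in `F ⊆ L`. -/
def toMap (L : Type*) [Field L] [Algebra F L] (f : RatFunc F) : OnePoint L → OnePoint L
  | some x => open Classical in
      if aeval x f.denom = 0 then OnePoint.infty
      else ((aeval x f.num / aeval x f.denom : L) : OnePoint L)
  | none => open Classical in
      if f.denom.coeff (degree f) = 0 then OnePoint.infty
      else ((algebraMap F L (f.num.coeff (degree f) / f.denom.coeff (degree f)) : L) :
        OnePoint L)

/-- Critical points of `f = P / Q` in `ℙ¹(L)`. At a finite point the condition is `P Q' - P' Q = 0`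
(this is `f' = 0` if the point is not a pole, and `(1/f)' = 0` if it is one); the point `∞` is
critical for `f` if `0` is critical for `x ↦ f (1 / x)`. -/
def IsCritical (L : Type*) [Field L] [Algebra F L] (f : RatFunc F) : OnePoint L → Prop
  | some x => aeval x (wronskian f.num f.denom) = 0
  | none => (wronskian (reflect (degree f) f.num) (reflect (degree f) f.denom)).eval 0 = 0

/-- `f` is post-critically finite: every critical point (over the algebraically closed field `L`)
has a finite forward orbit. -/
def IsPCF (L : Type*) [Field L] [Algebra F L] (f : RatFunc F) : Prop :=
  ∀ c : OnePoint L, IsCritical L f c → (Set.range fun n : ℕ => (toMap L f)^[n] c).Finite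

/-- The set `Δ_f` of the differences `c - fⁿ(c)`, `c` critical, `n ≥ 1`. Since `c` or `fⁿ(c)` may be
`∞`, a difference `x - y` is recorded as the pair `(x, y)`. -/
def Delta (L : Type*) [Field L] [Algebra F L] (f : RatFunc F) : Set (OnePoint L × OnePoint L) :=
  {δ | ∃ c : OnePoint L, IsCritical L f c ∧ ∃ n : ℕ, 1 ≤ n ∧ δ = (c, (toMap L f)^[n] c)}

/-- Over a field of characteristic `p`: the largest `h` such that `f(x) = Q(x ^ (p ^ h))` for some
rational function `Q` is `h`. -/
def HasHeight (f : RatFunc F) (h : ℕ) : Prop :=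
  IsGreatest {h : ℕ | ∃ Q : RatFunc F,
    f = algebraMap F[X] (RatFunc F) (expand F (ringChar F ^ h) Q.num) /
        algebraMap F[X] (RatFunc F) (expand F (ringChar F ^ h) Q.denom)} h

end RationalMaps

/-! ### Reduction

A place of an algebraic closure `Kbar` of the number field `K` is given by its valuation ring `A`,
with residue field `IsLocalRing.ResidueField A`. -/

section Reduction

variable {L : Type*} [Field L]

/-- Reduction `ℙ¹(L) → ℙ¹(k)`, where `k` is the residue field of `A`: a point of `A` goes to its
residue class, all other points go to `∞`. -/
def red (A : ValuationSubring L) : OnePoint L → OnePoint (IsLocalRing.ResidueField A)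
  | some x => open Classical in
      if h : x ∈ A then ((IsLocalRing.residue A ⟨x, h⟩ : IsLocalRing.ResidueField A) :
        OnePoint (IsLocalRing.ResidueField A))
      else OnePoint.infty
  | none => OnePoint.infty

/-- The place `A` divides the difference `x - y` of two points of `ℙ¹(L)`. For finite points this
means that `x - y` is in the maximal ideal of `A`, or that both `1/x` and `1/y` are; the place
divides `x - ∞` if and only if it divides `1/x`. -/
def DividesDiff (A : ValuationSubring L) : OnePoint L × OnePoint L → Prop
  | (some x, some y) => A.valuation (x - y) < 1 ∨ (1 < A.valuation x ∧ 1 < A.valuation y)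
  | (some x, none) => 1 < A.valuation x
  | (none, some y) => 1 < A.valuation y
  | (none, none) => True

variable {K : Type*} [Field K] [Algebra K L]

theorem algebraMap_integer_mem (A : ValuationSubring L) (a : NumberField.RingOfIntegers K) :
    algebraMap K L (a : K) ∈ A := by
  have h1 : IsIntegral ℤ (algebraMap K L (a : K)) :=
    (NumberField.RingOfIntegers.isIntegral_coe a).map (algebraMap K L).toIntAlgHom
  have h2 : IsIntegral A (algebraMap K L (a : K)) := h1.tower_top
  obtain ⟨b, hb⟩ := IsIntegrallyClosed.isIntegral_iff.1 h2
  rw [← hb]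
  exact b.2

/-- Reduction modulo the place `A` of the algebraic integers of `K`. -/
def redInt (K : Type*) [Field K] [Algebra K L] (A : ValuationSubring L) :
    NumberField.RingOfIntegers K →+* IsLocalRing.ResidueField A :=
  (IsLocalRing.residue A).comp
    (((algebraMap K L).comp (algebraMap (NumberField.RingOfIntegers K) K)).codRestrict A.toSubring
      (fun a => algebraMap_integer_mem A a))

/-- The place `A` lies above the prime `𝔭` of `K`. -/
def LiesAbove [NumberField K] (A : ValuationSubring L)
    (𝔭 : IsDedekindDomain.HeightOneSpectrum (NumberField.RingOfIntegers K)) : Prop :=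
  RingHom.ker (redInt K A) = 𝔭.asIdeal

/-- `f` has good reduction at `A` (equivalently at the prime of `K` below `A`), and its reduction is
`g`: we can write `f = P / Q` with coefficients in `𝓞 K` such that the reductions of `P` and `Q` are
coprime and `g`, their quotient, has the same degree as `f`. -/
def IsGoodReduction (A : ValuationSubring L) (f : RatFunc K)
    (g : RatFunc (IsLocalRing.ResidueField A)) : Prop :=
  ∃ P Q : (NumberField.RingOfIntegers K)[X],
    f = algebraMap K[X] (RatFunc K) (P.map (algebraMap (NumberField.RingOfIntegers K) K)) /
        algebraMap K[X] (RatFunc K) (Q.map (algebraMap (NumberField.RingOfIntegers K) K)) ∧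
    Q.map (redInt K A) ≠ 0 ∧
    IsCoprime (P.map (redInt K A)) (Q.map (redInt K A)) ∧
    g = algebraMap (IsLocalRing.ResidueField A)[X] (RatFunc (IsLocalRing.ResidueField A))
          (P.map (redInt K A)) /
        algebraMap (IsLocalRing.ResidueField A)[X] (RatFunc (IsLocalRing.ResidueField A))
          (Q.map (redInt K A)) ∧
    degree g = degree f

/-- For `f` with good reduction `g` at `A`: there is a critical point `c` of `f` which is periodic
modulo `A`, and `α` is in the forward orbit of `c` modulo `A`. -/
def InPeriodicCriticalOrbitMod (A : ValuationSubring L) (f : RatFunc K)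
    (g : RatFunc (IsLocalRing.ResidueField A)) (α : OnePoint L) : Prop :=
  ∃ c : OnePoint L, IsCritical L f c ∧
    red A c ∈ Function.periodicPts (toMap (IsLocalRing.ResidueField A) g) ∧
    ∃ m : ℕ, (toMap (IsLocalRing.ResidueField A) g)^[m] (red A c) = red A α

end Reduction

/-! ### Arboreal representations -/

section Arboreal

variable {K : Type*} [Field K] {Kbar : Type*} [Field Kbar] [Algebra K Kbar]

theorem toMap_map (f : RatFunc K) (σ : Kbar ≃ₐ[K] Kbar) (x : OnePoint Kbar) :
    toMap Kbar f (x.map σ) = (toMap Kbar f x).map σ := by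
  have key : ∀ (p : K[X]) (x : Kbar), aeval (σ x) p = σ (aeval x p) := fun p x =>
    aeval_algHom_apply σ.toAlgHom x p
  induction x using OnePoint.rec with
  | infty =>
    change toMap Kbar f none = (toMap Kbar f none).map σ
    simp only [toMap]
    split_ifs <;> simp
  | coe x =>
    change toMap Kbar f (some (σ x)) = (toMap Kbar f (some x)).map σ
    by_cases h : aeval x f.denom = 0
    · have h' : aeval (σ x) f.denom = 0 := by rw [key, h, _root_.map_zero]
      simp only [toMap, if_pos h, if_pos h', OnePoint.map_infty]
    · have h' : aeval (σ x) f.denom ≠ 0 := by rwa [key, Ne, EmbeddingLike.map_eq_zero_iff]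
      simp only [toMap, if_neg h, if_neg h', key, OnePoint.map_some, map_div₀]

theorem toMap_iterate_map (f : RatFunc K) (σ : Kbar ≃ₐ[K] Kbar) (n : ℕ) (x : OnePoint Kbar) :
    (toMap Kbar f)^[n] (x.map σ) = ((toMap Kbar f)^[n] x).map σ := by
  induction n generalizing x with
  | zero => rfl
  | succ n ih => rw [Function.iterate_succ_apply, Function.iterate_succ_apply, toMap_map, ih]

theorem map_mul (σ τ : Kbar ≃ₐ[K] Kbar) (x : OnePoint Kbar) :
    x.map (σ * τ) = (x.map τ).map σ := by
  induction x using OnePoint.rec <;> rfl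

theorem map_one (x : OnePoint Kbar) : x.map (1 : Kbar ≃ₐ[K] Kbar) = x := by
  induction x using OnePoint.rec <;> rfl

/-- The absolute Galois group of `K(α)`: the stabilizer of `α` in the absolute Galois group of `K`.
It is the whole absolute Galois group of `K` if `α ∈ ℙ¹(K)`. -/
def baseGalois (K : Type*) [Field K] [Algebra K Kbar] (α : OnePoint Kbar) :
    Subgroup (Kbar ≃ₐ[K] Kbar) where
  carrier := {σ | α.map σ = α}
  one_mem' := map_one α
  mul_mem' {σ τ} hσ hτ := by
    change α.map (σ * τ) = α
    rw [map_mul, hτ, hσ]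
  inv_mem' {σ} hσ := by
    change α.map (σ⁻¹ : Kbar ≃ₐ[K] Kbar) = α
    conv_lhs => rw [← show α.map σ = α from hσ]
    rw [← map_mul, inv_mul_cancel, map_one]

/-- Vertices of the preimage tree of `f` with base point (root) `α`: pairs `(n, β)` with
`fⁿ(β) = α`. -/
def Tree (f : RatFunc K) (α : OnePoint Kbar) : Type _ :=
  {v : ℕ × OnePoint Kbar // (toMap Kbar f)^[v.1] v.2 = α}

/-- The edges of the preimage tree, directed towards the root: `(n + 1, β) → (n, f β)`. -/
def Edge (f : RatFunc K) (α : OnePoint Kbar) (v w : Tree f α) : Prop :=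
  v.1.1 = w.1.1 + 1 ∧ toMap Kbar f v.1.2 = w.1.2

theorem map_injective (σ : Kbar ≃ₐ[K] Kbar) :
    Function.Injective (OnePoint.map σ : OnePoint Kbar → OnePoint Kbar) := by
  intro x y h
  have := congrArg (fun z : OnePoint Kbar => z.map (σ⁻¹ : Kbar ≃ₐ[K] Kbar)) h
  simpa only [← map_mul, inv_mul_cancel, map_one] using this

/-- The automorphism `(n, β) ↦ (n, σ β)` of the preimage tree. -/
def treeAut (f : RatFunc K) (α : OnePoint Kbar) (σ : baseGalois K α) : Edge f α ≃r Edge f α where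
  toFun v := ⟨(v.1.1, v.1.2.map σ.1), by
    change (toMap Kbar f)^[v.1.1] (v.1.2.map σ.1) = α
    rw [toMap_iterate_map, v.2]
    exact σ.2⟩
  invFun v := ⟨(v.1.1, v.1.2.map (σ⁻¹).1), by
    change (toMap Kbar f)^[v.1.1] (v.1.2.map (σ⁻¹).1) = α
    rw [toMap_iterate_map, v.2]
    exact (σ⁻¹).2⟩
  left_inv v := by
    apply Subtype.ext
    apply Prod.ext
    · rfl
    · change (v.1.2.map σ.1).map (σ⁻¹).1 = v.1.2
      rw [← map_mul, ← Subgroup.coe_mul, inv_mul_cancel, Subgroup.coe_one, map_one]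
  right_inv v := by
    apply Subtype.ext
    apply Prod.ext
    · rfl
    · change (v.1.2.map (σ⁻¹).1).map σ.1 = v.1.2
      rw [← map_mul, ← Subgroup.coe_mul, mul_inv_cancel, Subgroup.coe_one, map_one]
  map_rel_iff' {v w} := by
    change (v.1.1 = w.1.1 + 1 ∧ toMap Kbar f (v.1.2.map σ.1) = w.1.2.map σ.1) ↔ Edge f α v w
    rw [toMap_map, (map_injective σ.1).eq_iff]
    rfl

/-- The arboreal representation of `f` with base point `α`: the action of the absolute Galois group
of `K(α)` on the tree of iterated preimages of `α`. -/
def arborealRep (f : RatFunc K) (α : OnePoint Kbar) :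
    baseGalois K α →* (Edge f α ≃r Edge f α) where
  toFun := treeAut f α
  map_one' := by
    ext v
    apply Subtype.ext
    exact Prod.ext rfl (map_one v.1.2)
  map_mul' σ τ := by
    ext v
    apply Subtype.ext
    exact Prod.ext rfl (map_mul σ.1 τ.1 v.1.2)

/-- The inertia group of the place `A` in the absolute Galois group of `K`. -/
def inertia (K : Type*) [Field K] [Algebra K Kbar] (A : ValuationSubring Kbar) :
    Subgroup (Kbar ≃ₐ[K] Kbar) :=
  (A.inertiaSubgroup K).map (A.decompositionSubgroup K).subtype

/-- For an extension `E` of `K(α)`, the restriction of the arboreal representation with base point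
`α` to the absolute Galois group of `E` is unramified at `A`: the inertia group of `A` in it acts
trivially. -/
def IsUnramifiedOver (f : RatFunc K) (α : OnePoint Kbar) (A : ValuationSubring Kbar)
    (E : IntermediateField K Kbar) : Prop :=
  ∀ σ : baseGalois K α, σ.1 ∈ E.fixingSubgroup → σ.1 ∈ inertia K A → arborealRep f α σ = 1

/-- The arboreal representation with base point `α` is infinitely ramified at `A`: there is no finite
extension `E` of `K(α)` such that its restriction to the absolute Galois group of `E` is unramified
at `A`. -/
def IsInfinitelyRamified (f : RatFunc K) (α : OnePoint Kbar) (A : ValuationSubring Kbar) : Prop :=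
  ¬ ∃ E : IntermediateField K Kbar, FiniteDimensional K E ∧ E.fixingSubgroup ≤ baseGalois K α ∧
    IsUnramifiedOver f α A E

end Arboreal

end ArborealPCF

end

/-!
# Ramification of arboreal representations of post-critically finite maps

The place `A` gives `ℙ¹(L)` a chordal distance (`chordal`), for which two points have the same
reduction exactly if their distance is less than one. Good reduction of `f` means that `f` is given by
a pair of forms over `A` without common zero modulo `A` (`IntegralModel`), and height zero means that
the Wronskian of this pair does not vanish modulo `A`. So `f` does not increase distances, and in a
residue disc its dilatation at `x` is governed by the value `wval x` of the Wronskian: `f` is an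
isometry on a residue disc without critical points, and a strict contraction on one which contains a
critical point (`chordal_map_eq`, `chordal_map_lt`). In particular, a critical residue disc contains
at most one periodic point (`eq_of_mem_periodicPts`).

*No ramification.* Inertia preserves distances and residue discs, so it fixes a point `x` outside the
critical discs as soon as it fixes `f x`. Going up the tree over `α`, only the points in critical discs
need attention. If no periodic critical disc leads to `α`, the tree points in a given critical disc
reach, in a bounded number of steps, the part of the tree that reduces to the point `α̃` or to a
periodic point. That part is in the closure of the forward orbit of `α`, because `f` is an isometry on
the cycle of discs of `α̃` and the orbit of `α` is recurrent (`exists_chordal_iterate_lt`: residue rings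
of number fields are finite); if `α̃` is not periodic, the part consists of `α` only. In either case
it is totally bounded and fixed by inertia. Its preimages under a bounded number of steps inherit both
properties after a finite extension, by an argument in the manner of Krasner (`tame_preimage`): the
fibres are uniformly separated, since by post-critical finiteness the critical orbits stay away from
`α` unless they contain `α`, in which case the part of the tree in question is finite. This gives
`exists_finite_fixing_tree`.

*Ramification.* If a periodic critical disc leads to `α`, a power of `f` maps the disc of `α` onto
itself as a strict contraction. A backward orbit of `α` under this power, in the disc of `α`, has
strictly increasing distances of successive points (`exists_backward_orbit`), unless `α` is periodic.
If a finite extension `E` made the tree unramified, these distances would be values of the inertia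
field of `A` over `E`. But those are discrete, since the inertia field is unramified over `E`
(`exists_valuation_le_of_inertia_fixed`). The latter fact is reduced to finite Galois extensions, where
the ramification index is the order of the inertia group, by lifting inertia groups
(`exists_lift_inertia`).
-/

noncomputable section

namespace PCFReduction

open Polynomial ArborealPCF

/-! ### Binary forms -/

section Forms

variable {R S : Type*} [CommRing R] [CommRing S]

/-- The value at `(a, b)` of the binary form of degree `D` whose dehomogenization is `W`, for
polynomials `W` of degree at most `D`. -/
def formEval (D : ℕ) (W : R[X]) (a b : R) : R :=
  ∑ i ∈ Finset.range (D + 1), W.coeff i * a ^ i * b ^ (D - i)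

theorem map_formEval (φ : R →+* S) (D : ℕ) (W : R[X]) (a b : R) :
    φ (formEval D W a b) = formEval D (W.map φ) (φ a) (φ b) := by
  simp [formEval]

theorem formEval_mul_mul (D : ℕ) (W : R[X]) (t a b : R) :
    formEval D W (t * a) (t * b) = t ^ D * formEval D W a b := by
  rw [formEval, formEval, Finset.mul_sum]
  refine Finset.sum_congr rfl fun i hi => ?_
  have hi' : i ≤ D := Nat.lt_succ_iff.1 (Finset.mem_range.1 hi)
  rw [mul_pow, mul_pow, ← Nat.add_sub_cancel' hi', pow_add, Nat.add_sub_cancel' hi']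
  ring

theorem formEval_one_right {D : ℕ} {W : R[X]} (hW : W.natDegree ≤ D) (a : R) :
    formEval D W a 1 = W.eval a := by
  rw [formEval, eval_eq_sum_range' (Nat.lt_succ_of_le hW)]
  simp

theorem formEval_reflect (D : ℕ) (W : R[X]) (a b : R) :
    formEval D (reflect D W) a b = formEval D W b a := by
  rw [formEval, formEval, ← Finset.sum_range_reflect]
  refine Finset.sum_congr rfl fun i hi => ?_
  have hi' : i ≤ D := Nat.lt_succ_iff.1 (Finset.mem_range.1 hi)
  rw [coeff_reflect, revAt_le (by omega), show D + 1 - 1 - i = D - i by omega,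
    show D - (D - i) = i by omega]
  ring

theorem natDegree_reflect_le (D : ℕ) {W : R[X]} (hW : W.natDegree ≤ D) :
    (reflect D W).natDegree ≤ D := by
  refine natDegree_le_iff_coeff_eq_zero.2 fun i hi => ?_
  rw [coeff_reflect, revAt_eq_self_of_lt hi]
  exact coeff_eq_zero_of_natDegree_lt (hW.trans_lt hi)

theorem formEval_one_left {D : ℕ} {W : R[X]} (hW : W.natDegree ≤ D) (b : R) :
    formEval D W 1 b = (reflect D W).eval b := by
  rw [← formEval_one_right (natDegree_reflect_le D hW), formEval_reflect]

theorem formEval_zero_right (D : ℕ) (W : R[X]) (a : R) :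
    formEval D W a 0 = W.coeff D * a ^ D := by
  rw [formEval, Finset.sum_range_succ, Finset.sum_eq_zero]
  · simp
  · intro i hi
    rw [zero_pow (by have := Finset.mem_range.1 hi; omega), mul_zero]

theorem formEval_add (D : ℕ) (V W : R[X]) (a b : R) :
    formEval D (V + W) a b = formEval D V a b + formEval D W a b := by
  simp [formEval, Finset.sum_add_distrib, add_mul]

theorem formEval_C_mul (D : ℕ) (c : R) (W : R[X]) (a b : R) :
    formEval D (C c * W) a b = c * formEval D W a b := by
  simp [formEval, Finset.mul_sum, mul_assoc]

theorem formEval_neg (D : ℕ) (W : R[X]) (a b : R) :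
    formEval D (-W) a b = -formEval D W a b := by
  simp [formEval]

theorem formEval_sub (D : ℕ) (V W : R[X]) (a b : R) :
    formEval D (V - W) a b = formEval D V a b - formEval D W a b := by
  rw [sub_eq_add_neg, formEval_add, formEval_neg, sub_eq_add_neg]

theorem formEval_eq_pow_mul_eval {F : Type*} [Field F] {D : ℕ} {W : F[X]} (hW : W.natDegree ≤ D)
    (a : F) {b : F} (hb : b ≠ 0) : formEval D W a b = b ^ D * W.eval (a / b) := by
  rw [← formEval_one_right hW, ← formEval_mul_mul, mul_one, mul_div_cancel₀ a hb]

end Forms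

/-! ### Homogeneous coordinates -/

section Points

variable {L : Type*} [Field L]

/-- The point of `ℙ¹(L)` with homogeneous coordinates `(a, b)` (`∞` if `b = 0`). -/
def mkPt (a b : L) : OnePoint L := open Classical in
  if b = 0 then OnePoint.infty else ((a / b : L) : OnePoint L)

theorem mkPt_zero (a : L) : mkPt a 0 = OnePoint.infty := if_pos rfl

theorem mkPt_of_ne (a : L) {b : L} (hb : b ≠ 0) : mkPt a b = ((a / b : L) : OnePoint L) := if_neg hb

theorem mkPt_one (a : L) : mkPt a 1 = (a : OnePoint L) := by
  rw [mkPt_of_ne a one_ne_zero, div_one]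

theorem mkPt_eq_iff {a b a' b' : L} (h : a ≠ 0 ∨ b ≠ 0) (h' : a' ≠ 0 ∨ b' ≠ 0) :
    mkPt a b = mkPt a' b' ↔ a * b' - a' * b = 0 := by
  by_cases hb : b = 0
  · subst hb
    have ha : a ≠ 0 := by tauto
    by_cases hb' : b' = 0
    · subst hb'; simp [mkPt_zero]
    · rw [mkPt_zero, mkPt_of_ne _ hb']
      simp [ha, hb', OnePoint.infty_ne_coe]
  · by_cases hb' : b' = 0
    · subst hb'
      have ha : a' ≠ 0 := by tauto
      rw [mkPt_zero, mkPt_of_ne _ hb]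
      simp [ha, hb, OnePoint.coe_ne_infty]
    · rw [mkPt_of_ne _ hb, mkPt_of_ne _ hb', OnePoint.coe_eq_coe, div_eq_div_iff hb hb', sub_eq_zero]

theorem mkPt_mul_mul {t : L} (ht : t ≠ 0) (a b : L) : mkPt (t * a) (t * b) = mkPt a b := by
  by_cases hb : b = 0
  · simp [hb, mkPt_zero]
  · rw [mkPt_of_ne _ hb, mkPt_of_ne _ (mul_ne_zero ht hb), mul_div_mul_left _ _ ht]

end Points

section Coordinates

variable {L : Type*} [Field L] (A : ValuationSubring L)

/-- The first of the unimodular coordinates over `A` of a point: they are `(x, 1)` for `x ∈ A`,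
`(1, x⁻¹)` for `x ∉ A`, and `(1, 0)` for `∞`. -/
def coordX : OnePoint L → A
  | some x => open Classical in if h : x ∈ A then ⟨x, h⟩ else 1
  | none => 1

/-- The second of the unimodular coordinates over `A` of a point: they are `(x, 1)` for `x ∈ A`,
`(1, x⁻¹)` for `x ∉ A`, and `(1, 0)` for `∞`. -/
def coordY : OnePoint L → A
  | some x => open Classical in
      if h : x ∈ A then 1 else ⟨x⁻¹, (A.mem_or_inv_mem x).resolve_left h⟩
  | none => 0

variable {A}

/-- The vector `(a, b)` over `A` is unimodular. -/
def Unimod (a b : A) : Prop := IsUnit a ∨ IsUnit b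

theorem coordX_coe_mem {x : L} (hx : x ∈ A) : coordX A (x : OnePoint L) = ⟨x, hx⟩ := dif_pos hx
theorem coordY_coe_mem {x : L} (hx : x ∈ A) : coordY A (x : OnePoint L) = 1 := dif_pos hx
theorem coordX_coe_notMem {x : L} (hx : x ∉ A) : coordX A (x : OnePoint L) = 1 := dif_neg hx
theorem coordY_coe_notMem {x : L} (hx : x ∉ A) : coordY A (x : OnePoint L) =
    ⟨x⁻¹, (A.mem_or_inv_mem x).resolve_left hx⟩ := dif_neg hx
theorem coordX_infty : coordX A (OnePoint.infty : OnePoint L) = 1 := rfl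
theorem coordY_infty : coordY A (OnePoint.infty : OnePoint L) = 0 := rfl

variable (A) in
theorem coordX_eq_one_or_coordY_eq_one (x : OnePoint L) : coordX A x = 1 ∨ coordY A x = 1 := by
  induction x using OnePoint.rec with
  | infty => exact Or.inl rfl
  | coe x =>
    by_cases hx : x ∈ A
    · exact Or.inr (coordY_coe_mem hx)
    · exact Or.inl (coordX_coe_notMem hx)

theorem unimod_coord (x : OnePoint L) : Unimod (coordX A x) (coordY A x) :=
  (coordX_eq_one_or_coordY_eq_one A x).imp (fun h => by rw [h]; exact isUnit_one) fun h => by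
    rw [h]; exact isUnit_one

theorem mkPt_coord (x : OnePoint L) : mkPt (coordX A x : L) (coordY A x : L) = x := by
  induction x using OnePoint.rec with
  | infty => exact mkPt_zero _
  | coe x =>
    by_cases hx : x ∈ A
    · rw [coordX_coe_mem hx, coordY_coe_mem hx]
      exact mkPt_one x
    · have h0 : x ≠ 0 := fun h => hx (h ▸ A.zero_mem)
      rw [coordX_coe_notMem hx, coordY_coe_notMem hx, mkPt_of_ne _ (inv_ne_zero h0)]
      simp

theorem Unimod.ne_zero {a b : A} (h : Unimod a b) : (a : L) ≠ 0 ∨ (b : L) ≠ 0 :=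
  h.imp (fun h h0 => h.ne_zero (Subtype.ext h0)) fun h h0 => h.ne_zero (Subtype.ext h0)

theorem Unimod.residue_ne_zero {a b : A} (h : Unimod a b) :
    IsLocalRing.residue A a ≠ 0 ∨ IsLocalRing.residue A b ≠ 0 := by
  simpa only [Unimod, IsLocalRing.residue_ne_zero_iff_isUnit] using h

theorem unimod_iff_residue {a b : A} :
    Unimod a b ↔ IsLocalRing.residue A a ≠ 0 ∨ IsLocalRing.residue A b ≠ 0 := by
  simp only [Unimod, IsLocalRing.residue_ne_zero_iff_isUnit]

/-- Two unimodular coordinate vectors of a point differ by a unit. -/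
theorem Unimod.exists_unit {a b : A} (h : Unimod a b) :
    ∃ u : Aˣ, a = u * coordX A (mkPt (a : L) b) ∧ b = u * coordY A (mkPt (a : L) b) := by
  set x := mkPt (a : L) b with hx
  have key : a * coordY A x = coordX A x * b := by
    have := (mkPt_eq_iff h.ne_zero (unimod_coord (A := A) x).ne_zero).1 (hx.symm.trans (mkPt_coord x).symm)
    exact_mod_cast sub_eq_zero.1 this
  rcases coordX_eq_one_or_coordY_eq_one A x with h1 | h1
  · rw [h1, one_mul] at key
    have ha : IsUnit a := h.elim id fun hb => isUnit_of_mul_isUnit_left (key ▸ hb)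
    exact ⟨ha.unit, by simp [h1], by simp [key]⟩
  · rw [h1, mul_one] at key
    have hb : IsUnit b := h.elim (fun ha => isUnit_of_mul_isUnit_right (key ▸ ha)) id
    exact ⟨hb.unit, by simp [key, mul_comm], by simp [h1]⟩

/-- Reduction can be computed in any unimodular coordinates. -/
theorem red_mkPt {a b : A} (h : Unimod a b) :
    red A (mkPt (a : L) b) = mkPt (IsLocalRing.residue A a) (IsLocalRing.residue A b) := by
  have base : ∀ x : OnePoint L,
      red A x = mkPt (IsLocalRing.residue A (coordX A x)) (IsLocalRing.residue A (coordY A x)) := by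
    intro x
    induction x using OnePoint.rec with
    | infty => simp [coordY_infty, mkPt_zero]; rfl
    | coe x =>
      by_cases hx : x ∈ A
      · rw [coordX_coe_mem hx, coordY_coe_mem hx, _root_.map_one, mkPt_one]
        exact dif_pos hx
      · have h0 : IsLocalRing.residue A (coordY A (x : OnePoint L)) = 0 := by
          rw [coordY_coe_notMem hx, IsLocalRing.residue_eq_zero_iff, A.valuation_lt_one_iff]
          rw [map_inv₀]
          exact inv_lt_one_of_one_lt₀ (lt_of_not_ge fun h => hx (A.mem_of_valuation_le_one x h))
        rw [h0, mkPt_zero]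
        exact dif_neg hx
  obtain ⟨u, h1, h2⟩ := h.exists_unit
  rw [base]
  generalize mkPt (a : L) b = x at h1 h2 ⊢
  rw [h1, h2, _root_.map_mul, _root_.map_mul,
    mkPt_mul_mul ((IsLocalRing.residue_ne_zero_iff_isUnit _).2 u.isUnit)]

/-! ### The chordal distance -/

variable (A) in
/-- The chordal distance of two points of `ℙ¹(L)` for the place `A`: the value of the determinant of
unimodular coordinate vectors. -/
def chordal (x y : OnePoint L) : A.ValueGroup :=
  A.valuation ((coordX A x : L) * coordY A y - coordX A y * coordY A x)

theorem chordal_mkPt {a b a' b' : A} (h : Unimod a b) (h' : Unimod a' b') :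
    chordal A (mkPt (a : L) b) (mkPt (a' : L) b') = A.valuation ((a : L) * b' - a' * b) := by
  obtain ⟨u, h1, h2⟩ := h.exists_unit
  obtain ⟨u', h1', h2'⟩ := h'.exists_unit
  set x := mkPt (a : L) b
  set y := mkPt (a' : L) b'
  have : ((a : L) * b' - a' * b) =
      ((u : A) : L) * ((u' : A) : L) * ((coordX A x : L) * coordY A y - coordX A y * coordY A x) := by
    rw [h1, h2, h1', h2']
    push_cast
    ring
  rw [this, _root_.map_mul, _root_.map_mul, A.valuation_unit, A.valuation_unit, one_mul, one_mul]
  rfl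

theorem chordal_comm (x y : OnePoint L) : chordal A x y = chordal A y x := by
  rw [chordal, chordal, ← Valuation.map_neg]
  congr 1
  ring

theorem chordal_le_one (x y : OnePoint L) : chordal A x y ≤ 1 :=
  (A.valuation_le_iff _ _).2 ⟨coordX A x * coordY A y - coordX A y * coordY A x, by simp⟩ |>.trans_eq
    A.valuation.map_one

theorem chordal_eq_zero_iff {x y : OnePoint L} : chordal A x y = 0 ↔ x = y := by
  rw [chordal, Valuation.zero_iff, ← mkPt_eq_iff (unimod_coord x).ne_zero (unimod_coord y).ne_zero,
    mkPt_coord, mkPt_coord]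

theorem chordal_self (x : OnePoint L) : chordal A x x = 0 := chordal_eq_zero_iff.2 rfl

theorem chordal_lt_one_iff {x y : OnePoint L} : chordal A x y < 1 ↔ red A x = red A y := by
  have h1 := red_mkPt (unimod_coord (A := A) x)
  have h2 := red_mkPt (unimod_coord (A := A) y)
  rw [mkPt_coord] at h1 h2
  rw [h1, h2, mkPt_eq_iff (unimod_coord x).residue_ne_zero (unimod_coord y).residue_ne_zero,
    ← _root_.map_mul, ← _root_.map_mul, ← map_sub, IsLocalRing.residue_eq_zero_iff,
    A.valuation_lt_one_iff]
  simp [chordal]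

theorem chordal_triangle (x y z : OnePoint L) :
    chordal A x z ≤ max (chordal A x y) (chordal A y z) := by
  have hle : ∀ (a : A) (t : L), A.valuation (a * t) ≤ A.valuation t := fun a t => by
    rw [_root_.map_mul]
    exact mul_le_of_le_one_left' (A.valuation_le_one a)
  rcases coordX_eq_one_or_coordY_eq_one A y with h1 | h1
  · have : (coordX A x : L) * coordY A z - coordX A z * coordY A x =
      (coordX A z : L) * ((coordX A x : L) * coordY A y - coordX A y * coordY A x) +
      (coordX A x : L) * ((coordX A y : L) * coordY A z - coordX A z * coordY A y) := by
      rw [h1]; push_cast; ring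
    rw [chordal, this]
    exact (A.valuation.map_add _ _).trans (max_le_max (hle _ _) (hle _ _))
  · have : (coordX A x : L) * coordY A z - coordX A z * coordY A x =
      (coordY A z : L) * ((coordX A x : L) * coordY A y - coordX A y * coordY A x) +
      (coordY A x : L) * ((coordX A y : L) * coordY A z - coordX A z * coordY A y) := by
      rw [h1]; push_cast; ring
    rw [chordal, this]
    exact (A.valuation.map_add _ _).trans (max_le_max (hle _ _) (hle _ _))

theorem chordal_lt_of_lt {x y z : OnePoint L} {ε : A.ValueGroup} (h : chordal A x y < ε)
    (h' : chordal A y z < ε) : chordal A x z < ε :=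
  (chordal_triangle x y z).trans_lt (max_lt h h')

/-- Points in the same residue disc have coordinates in the same standard chart. -/
theorem exists_chart {x y : OnePoint L} (h : chordal A x y < 1) :
    (∃ a b : A, x = mkPt (a : L) (1 : A) ∧ y = mkPt (b : L) (1 : A)) ∨
    (∃ a b : A, x = mkPt ((1 : A) : L) a ∧ y = mkPt ((1 : A) : L) b) := by
  have hr := chordal_lt_one_iff.1 h
  by_cases hx : coordY A x = 1
  · by_cases hy : coordY A y = 1
    · exact Or.inl ⟨_, _, hx ▸ (mkPt_coord x).symm, hy ▸ (mkPt_coord y).symm⟩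
    · have hy' := (coordX_eq_one_or_coordY_eq_one A y).resolve_right hy
      have : IsUnit (coordY A y) := by
        by_contra hu
        have h1 := red_mkPt (unimod_coord (A := A) x)
        have h2 := red_mkPt (unimod_coord (A := A) y)
        have h0 : IsLocalRing.residue A (coordY A y) = 0 := by
          by_contra h0; exact hu ((IsLocalRing.residue_ne_zero_iff_isUnit _).1 h0)
        rw [mkPt_coord] at h1 h2
        rw [h1, h2, h0, mkPt_zero, hx, _root_.map_one, mkPt_one] at hr
        exact OnePoint.coe_ne_infty _ hr
      refine Or.inl ⟨coordX A x, ((this.unit⁻¹ : Aˣ) : A), hx ▸ (mkPt_coord x).symm, ?_⟩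
      have h3 : (((this.unit⁻¹ : Aˣ) : A) : L) * (coordY A y : L) = 1 := by
        have := this.val_inv_mul
        exact_mod_cast this
      conv_lhs => rw [← mkPt_coord (A := A) y, hy']
      rw [← mkPt_mul_mul (t := (((this.unit⁻¹ : Aˣ) : A) : L)) (left_ne_zero_of_mul_eq_one h3), h3]
      simp
  · have hx' := (coordX_eq_one_or_coordY_eq_one A x).resolve_right hx
    by_cases hy : coordX A y = 1
    · exact Or.inr ⟨_, _, hx' ▸ (mkPt_coord x).symm, hy ▸ (mkPt_coord y).symm⟩
    · have hy' := (coordX_eq_one_or_coordY_eq_one A y).resolve_left hy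
      have hu : IsUnit (coordY A x) := by
        by_contra hu
        have h1 := red_mkPt (unimod_coord (A := A) x)
        have h2 := red_mkPt (unimod_coord (A := A) y)
        have h0 : IsLocalRing.residue A (coordY A x) = 0 := by
          by_contra h0; exact hu ((IsLocalRing.residue_ne_zero_iff_isUnit _).1 h0)
        rw [mkPt_coord] at h1 h2
        rw [h1, h2, h0, mkPt_zero, hy', _root_.map_one, mkPt_one] at hr
        exact OnePoint.coe_ne_infty _ hr.symm
      refine Or.inl ⟨((hu.unit⁻¹ : Aˣ) : A), coordX A y, ?_, hy' ▸ (mkPt_coord y).symm⟩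
      have h3 : (((hu.unit⁻¹ : Aˣ) : A) : L) * (coordY A x : L) = 1 := by
        have := hu.val_inv_mul
        exact_mod_cast this
      conv_lhs => rw [← mkPt_coord (A := A) x, hx']
      rw [← mkPt_mul_mul (t := (((hu.unit⁻¹ : Aˣ) : A) : L)) (left_ne_zero_of_mul_eq_one h3), h3]
      simp

theorem dividesDiff_iff (x y : OnePoint L) : DividesDiff A (x, y) ↔ red A x = red A y := by
  rw [← chordal_lt_one_iff]
  have aux : ∀ x : L, 1 < A.valuation x ↔ x ∉ A := fun x => by
    rw [← A.valuation_le_one_iff, not_le]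
  have aux' : ∀ x : L, x ∉ A → A.valuation x⁻¹ < 1 := fun x hx => by
    rw [map_inv₀]; exact inv_lt_one_of_one_lt₀ ((aux x).2 hx)
  induction x using OnePoint.rec with
  | infty =>
    induction y using OnePoint.rec with
    | infty => simp only [chordal_self, zero_lt_one, iff_true]; trivial
    | coe y =>
      change 1 < A.valuation y ↔ _
      rw [aux]
      by_cases hy : y ∈ A
      · simp [chordal, coordX_infty, coordY_infty, coordY_coe_mem hy, hy]
      · simpa [chordal, coordX_infty, coordY_infty, coordY_coe_notMem hy, hy] using aux' y hy
  | coe x =>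
    induction y using OnePoint.rec with
    | infty =>
      change 1 < A.valuation x ↔ _
      rw [aux]
      by_cases hx : x ∈ A
      · simp [chordal, coordX_infty, coordY_infty, coordY_coe_mem hx, hx]
      · simpa [chordal, coordX_infty, coordY_infty, coordY_coe_notMem hx, hx,
          Valuation.map_neg] using aux' x hx
    | coe y =>
      change (A.valuation (x - y) < 1 ∨ (1 < A.valuation x ∧ 1 < A.valuation y)) ↔ _
      rw [aux, aux]
      by_cases hx : x ∈ A
      · by_cases hy : y ∈ A
        · simp [chordal, coordX_coe_mem hx, coordY_coe_mem hx, coordX_coe_mem hy, coordY_coe_mem hy,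
            hx]
        · have h1 : ¬ A.valuation (x - y) < 1 := fun h =>
            hy (by simpa using A.sub_mem hx ((A.valuation_le_one_iff _).1 h.le))
          have h2 : ¬ A.valuation (x * y⁻¹ - 1) < 1 := fun h => by
            have h3 : A.valuation (x * y⁻¹) < 1 := by
              rw [_root_.map_mul]
              exact mul_lt_of_le_one_of_lt ((A.valuation_le_one_iff _).2 hx) (aux' y hy)
            have := A.valuation.map_sub (x * y⁻¹) (x * y⁻¹ - 1)
            rw [sub_sub_cancel, _root_.map_one] at this
            exact absurd (max_lt h3 h) (not_lt.2 this)
          simpa [chordal, coordX_coe_mem hx, coordY_coe_mem hx, coordX_coe_notMem hy,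
            coordY_coe_notMem hy, hx, h1] using not_lt.1 h2
      · by_cases hy : y ∈ A
        · have h1 : ¬ A.valuation (x - y) < 1 := fun h =>
            hx (by simpa using A.add_mem _ _ ((A.valuation_le_one_iff _).1 h.le) hy)
          have h2 : ¬ A.valuation (1 - y * x⁻¹) < 1 := fun h => by
            have h3 : A.valuation (y * x⁻¹) < 1 := by
              rw [_root_.map_mul]
              exact mul_lt_of_le_one_of_lt ((A.valuation_le_one_iff _).2 hy) (aux' x hx)
            have := A.valuation.map_add (1 - y * x⁻¹) (y * x⁻¹)
            rw [sub_add_cancel, _root_.map_one] at this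
            exact absurd (max_lt h h3) (not_lt.2 this)
          simpa [chordal, coordX_coe_mem hy, coordY_coe_mem hy, coordX_coe_notMem hx,
            coordY_coe_notMem hx, hy, h1] using not_lt.1 h2
        · have h1 : A.valuation (y⁻¹ - x⁻¹) < 1 :=
            (A.valuation.map_sub _ _).trans_lt (max_lt (aux' y hy) (aux' x hx))
          simpa [chordal, coordX_coe_notMem hx, coordY_coe_notMem hx, coordX_coe_notMem hy,
            coordY_coe_notMem hy, hx, hy] using h1

end Coordinates

/-! ### Factorization of forms over a valuation ring -/

section Factorization

variable {L : Type*} [Field L] [IsAlgClosed L] {A : ValuationSubring L}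

theorem isAlgClosed_residueField : IsAlgClosed (IsLocalRing.ResidueField A) := by
  refine IsAlgClosed.of_exists_root _ fun p hp hirr => ?_
  obtain ⟨q, hq, hdeg, hmon⟩ := lifts_and_degree_eq_and_monic
    ((lifts_iff_coeff_lifts p).2 fun n => IsLocalRing.residue_surjective _) hp
  have h1 : (q.map A.subtype).degree ≠ 0 := by
    rw [hmon.degree_map, hdeg]
    exact fun h => hirr.not_isUnit (isUnit_iff_degree_eq_zero.2 h)
  obtain ⟨x, hx⟩ := IsAlgClosed.exists_root _ h1
  have hint : IsIntegral A x := ⟨q, hmon, by rwa [IsRoot.def, eval_map] at hx⟩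
  obtain ⟨y, rfl⟩ := IsIntegrallyClosed.isIntegral_iff.1 hint
  refine ⟨IsLocalRing.residue A y, ?_⟩
  have h2 : q.eval y = 0 := by
    apply A.subtype_injective
    rw [IsRoot.def, eval_map] at hx
    rw [_root_.map_zero, ← hx, eval, hom_eval₂]
    rfl
  rw [← hq, eval_map_apply, h2, _root_.map_zero]

theorem exists_formEval_eq_prod_roots {D : ℕ} {W : L[X]} (hD : W.natDegree ≤ D) (a b : L) :
    formEval D W a b =
      W.leadingCoeff * b ^ (D - W.natDegree) * (W.roots.map fun r => a - r * b).prod := by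
  have hsplit := IsAlgClosed.splits W
  have hcard : W.natDegree = W.roots.card := hsplit.natDegree_eq_card_roots
  by_cases hb : b = 0
  · subst hb
    rw [formEval_zero_right]
    simp only [mul_zero, sub_zero, Multiset.map_const', Multiset.prod_replicate, ← hcard]
    rcases hD.eq_or_lt with h | h
    · rw [← h, coeff_natDegree]; simp
    · rw [coeff_eq_zero_of_natDegree_lt h, zero_pow (by omega)]; simp
  · rw [formEval_eq_pow_mul_eval hD a hb]
    conv_lhs => rw [hsplit.eval_eq_prod_roots]
    have : (W.roots.map fun r => a - r * b) = (W.roots.map fun r => b * (a / b - r)) := by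
      refine Multiset.map_congr rfl fun r _ => ?_
      field_simp
    rw [this, Multiset.prod_map_mul, Multiset.map_const', Multiset.prod_replicate, ← hcard,
      ← Nat.sub_add_cancel hD, pow_add, Nat.add_sub_cancel]
    ring

/-- A binary form over `A` whose reduction is not zero has, at unimodular vectors, the value given by
the product of the chordal distances to its zeros. -/
theorem exists_valuation_formEval_eq_prod {D : ℕ} {W : A[X]} (hD : W.natDegree ≤ D)
    (hW : W.map (IsLocalRing.residue A) ≠ 0) :
    ∃ s : Multiset (OnePoint L), s.card = D ∧ ∀ a b : A, Unimod a b →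
      A.valuation (formEval D W a b : A) = (s.map fun c => chordal A c (mkPt (a : L) b)).prod := by
  classical
  have := isAlgClosed_residueField (A := A)
  have : Infinite (IsLocalRing.ResidueField A) := IsAlgClosed.instInfinite
  set V : L[X] := W.map A.subtype with hV
  have hVD : V.natDegree ≤ D := natDegree_map_le.trans hD
  have hcard : V.natDegree = V.roots.card := (IsAlgClosed.splits V).natDegree_eq_card_roots
  let s : Multiset (OnePoint L) :=
    Multiset.map (OnePoint.some : L → OnePoint L) V.roots + Multiset.replicate (D - V.natDegree) OnePoint.infty
  -- the factor relating `a - r * b` to the chordal distance from `r`, as `(r, 1)` may not be integral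
  let κ : L → A.ValueGroup := fun r => if r ∈ A then 1 else A.valuation r
  have hκ : ∀ (r : L) (a b : A), Unimod a b →
      A.valuation ((a : L) - r * b) = κ r * chordal A (r : OnePoint L) (mkPt (a : L) b) := by
    intro r a b hab
    by_cases hr : r ∈ A
    · have : (r : OnePoint L) = mkPt ((⟨r, hr⟩ : A) : L) ((1 : A) : L) := (mkPt_one r).symm
      rw [this, chordal_mkPt (Or.inr isUnit_one) hab]
      simp only [κ, if_pos hr, one_mul]
      rw [← Valuation.map_neg]
      congr 1
      push_cast
      ring
    · have h0 : r ≠ 0 := fun h => hr (h ▸ A.zero_mem)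
      have : (r : OnePoint L) = mkPt ((1 : A) : L)
          ((⟨r⁻¹, (A.mem_or_inv_mem r).resolve_left hr⟩ : A) : L) := by
        rw [mkPt_of_ne _ (inv_ne_zero h0)]
        simp
      rw [this, chordal_mkPt (Or.inl isUnit_one) hab]
      simp only [κ, if_neg hr]
      rw [← _root_.map_mul, ← Valuation.map_neg]
      congr 1
      push_cast
      field_simp
      ring
  have hinf : ∀ a b : A, Unimod a b →
      A.valuation (b : L) = chordal A OnePoint.infty (mkPt (a : L) b) := by
    intro a b hab
    have : (OnePoint.infty : OnePoint L) = mkPt ((1 : A) : L) ((0 : A) : L) := (mkPt_zero _).symm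
    rw [this, chordal_mkPt (Or.inl isUnit_one) hab]
    simp
  have main : ∀ a b : A, Unimod a b → A.valuation (formEval D W a b : A) =
      (A.valuation V.leadingCoeff * (V.roots.map κ).prod) *
        (s.map fun c => chordal A c (mkPt (a : L) b)).prod := by
    intro a b hab
    have h1 : ((formEval D W a b : A) : L) = formEval D V a b := map_formEval A.subtype D W a b
    rw [h1, exists_formEval_eq_prod_roots hVD, _root_.map_mul, _root_.map_mul, map_pow,
      map_multiset_prod, Multiset.map_map, Multiset.map_add, Multiset.prod_add, Multiset.map_map,
      Multiset.map_replicate, Multiset.prod_replicate, hinf a b hab]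
    have h2 : V.roots.map (A.valuation ∘ fun r => (a : L) - r * b) =
        V.roots.map fun r => κ r * chordal A (r : OnePoint L) (mkPt (a : L) b) :=
      Multiset.map_congr rfl fun r _ => hκ r a b hab
    rw [h2, Multiset.prod_map_mul]
    simp only [Function.comp_def, mul_comm, mul_assoc, mul_left_comm]
  -- a point where the form is a unit and which is in the residue disc of no zero
  have hfin : ({t | t ∈ (W.map (IsLocalRing.residue A)).roots.toFinset} ∪
      (OnePoint.some : _ → OnePoint (IsLocalRing.ResidueField A)) ⁻¹'
        {t | t ∈ (s.map (red A)).toFinset}).Finite :=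
    (Finset.finite_toSet _).union
      ((Finset.finite_toSet (s.map (red A)).toFinset).preimage OnePoint.coe_injective.injOn)
  obtain ⟨t, ht⟩ := hfin.exists_notMem
  obtain ⟨a, rfl⟩ := IsLocalRing.residue_surjective t
  simp only [Set.mem_union, Set.mem_preimage, Set.mem_ofPred_eq, not_or, Multiset.mem_toFinset,
    mem_roots hW, IsRoot.def] at ht
  have hun : Unimod a 1 := Or.inr isUnit_one
  have hs : (s.map fun c => chordal A c (mkPt (a : L) ((1 : A) : L))).prod = 1 := by
    refine Multiset.prod_eq_one fun y hy => ?_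
    obtain ⟨c, hc, rfl⟩ := Multiset.mem_map.1 hy
    refine le_antisymm (chordal_le_one _ _) (not_lt.1 fun hlt => ht.2 ?_)
    refine Multiset.mem_map.2 ⟨c, hc, ?_⟩
    rw [chordal_lt_one_iff.1 hlt, red_mkPt hun, _root_.map_one, mkPt_one]
  have hC : A.valuation V.leadingCoeff * (V.roots.map κ).prod = 1 := by
    have h1 := main a 1 hun
    rw [hs, mul_one, formEval_one_right hD] at h1
    rw [← h1, ← A.valuation_eq_one_iff, ← IsLocalRing.residue_ne_zero_iff_isUnit,
      ← eval_map_apply]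
    exact ht.1
  refine ⟨s, by simp [s, ← hcard, Nat.add_sub_cancel' hVD], fun a b hab => ?_⟩
  rw [main a b hab, hC, one_mul]

end Factorization

/-! ### Wronskians as binary forms -/

section Wronskian

variable {R : Type*} [CommRing R]

theorem wronskian_X_pow (i j : ℕ) :
    wronskian (X ^ i : R[X]) (X ^ j) = C ((j : R) - i) * X ^ (i + j - 1) := by
  rw [wronskian, derivative_X_pow, derivative_X_pow]
  rcases i with _ | i
  · rcases j with _ | j <;> simp
  · rcases j with _ | j
    · simp; ring
    · simp only [Nat.add_sub_cancel, show i + 1 + (j + 1) - 1 = i + j + 1 by omega, map_sub]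
      ring

/-- The Wronskian in terms of the coefficients; the exponent `i + j - 1` is truncated only in terms with
`i = j = 0`, which vanish. -/
theorem wronskian_eq_sum {d : ℕ} {p q : R[X]} (hp : p.natDegree ≤ d) (hq : q.natDegree ≤ d) :
    wronskian p q = ∑ i ∈ Finset.range (d + 1), ∑ j ∈ Finset.range (d + 1),
      C (p.coeff i * q.coeff j * ((j : R) - i)) * X ^ (i + j - 1) := by
  conv_lhs => rw [as_sum_range_C_mul_X_pow' p (Nat.lt_succ_of_le hp),
    as_sum_range_C_mul_X_pow' q (Nat.lt_succ_of_le hq), ← wronskianBilin_apply]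
  simp only [map_sum, LinearMap.sum_apply, ← smul_eq_C_mul, map_smul, LinearMap.smul_apply,
    wronskianBilin_apply, wronskian_X_pow]
  simp only [Finset.smul_sum, smul_smul]
  rw [Finset.sum_comm]
  refine Finset.sum_congr rfl fun i _ => Finset.sum_congr rfl fun j _ => ?_
  congr 1
  ring

theorem natDegree_wronskian_le {d : ℕ} {p q : R[X]} (hp : p.natDegree ≤ d) (hq : q.natDegree ≤ d) :
    (wronskian p q).natDegree ≤ 2 * d - 2 := by
  rw [wronskian_eq_sum hp hq]
  refine natDegree_sum_le_of_forall_le _ _ fun i hi => natDegree_sum_le_of_forall_le _ _ fun j hj => ?_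
  have hi' := Finset.mem_range.1 hi
  have hj' := Finset.mem_range.1 hj
  by_cases h : i = j
  · simp [h]
  · exact (natDegree_C_mul_X_pow_le _ _).trans (by omega)

/-- Exchanging the two standard charts changes the sign of the Wronskian. -/
theorem reflect_wronskian {d : ℕ} {p q : R[X]} (hp : p.natDegree ≤ d)
    (hq : q.natDegree ≤ d) :
    reflect (2 * d - 2) (wronskian p q) = -wronskian (reflect d p) (reflect d q) := by
  let φ : ℕ → R[X] →+ R[X] := fun N =>
    { toFun := reflect N, map_zero' := reflect_zero, map_add' := fun a b => reflect_add a b N }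
  have hφ : ∀ N f, reflect N f = φ N f := fun _ _ => rfl
  rw [wronskian_eq_sum hp hq, wronskian_eq_sum (natDegree_reflect_le d hp) (natDegree_reflect_le d hq),
    hφ]
  simp only [map_sum]
  simp only [← hφ, reflect_C_mul_X_pow]
  rw [← Finset.sum_neg_distrib]
  conv_rhs => rw [← Finset.sum_range_reflect]
  refine Finset.sum_congr rfl fun i hi => ?_
  rw [← Finset.sum_neg_distrib]
  conv_rhs => rw [← Finset.sum_range_reflect]
  refine Finset.sum_congr rfl fun j hj => ?_
  have hi' := Finset.mem_range.1 hi
  have hj' := Finset.mem_range.1 hj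
  rw [show d + 1 - 1 - i = d - i by omega, show d + 1 - 1 - j = d - j by omega, coeff_reflect,
    coeff_reflect, revAt_le (Nat.sub_le d i), revAt_le (Nat.sub_le d j),
    show d - (d - i) = i by omega, show d - (d - j) = j by omega]
  by_cases h : i = j
  · simp [h]
  · rw [revAt_le (by omega), ← neg_mul, ← C_neg,
      show 2 * d - 2 - (i + j - 1) = d - i + (d - j) - 1 by omega,
      Nat.cast_sub (by omega), Nat.cast_sub (by omega)]
    congr 2
    ring

theorem map_wronskian {S : Type*} [CommRing S] (φ : R →+* S) (p q : R[X]) :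
    (wronskian p q).map φ = wronskian (p.map φ) (q.map φ) := by
  simp [wronskian, derivative_map]

theorem wronskian_C_mul_C_mul (c : R) (p q : R[X]) :
    wronskian (C c * p) (C c * q) = C (c ^ 2) * wronskian p q := by
  simp only [wronskian, derivative_C_mul, C_pow]
  ring

end Wronskian

/-! ### Rational maps in homogeneous coordinates -/

section RationalMaps

variable {F : Type*} [Field F] {L : Type*} [Field L] [Algebra F L]

theorem natDegree_num_le (f : RatFunc F) : f.num.natDegree ≤ ArborealPCF.degree f := le_max_left _ _
theorem natDegree_denom_le (f : RatFunc F) : f.denom.natDegree ≤ ArborealPCF.degree f :=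
  le_max_right _ _

variable {f : RatFunc F} {c : L} {P Q : L[X]}

theorem natDegree_le_of_eq_C_mul_map {u : F[X]} {d : ℕ} (hu : u.natDegree ≤ d)
    (hP : P = C c * u.map (algebraMap F L)) : P.natDegree ≤ d := by
  rw [hP]
  exact (natDegree_C_mul_le _ _).trans (natDegree_map_le.trans hu)

/-- The map `f` in homogeneous coordinates, for any scaling of numerator and denominator. -/
theorem toMap_mkPt (hc : c ≠ 0) (hP : P = C c * f.num.map (algebraMap F L))
    (hQ : Q = C c * f.denom.map (algebraMap F L)) {a b : L} (hab : a ≠ 0 ∨ b ≠ 0) :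
    toMap L f (mkPt a b) =
      mkPt (formEval (ArborealPCF.degree f) P a b) (formEval (ArborealPCF.degree f) Q a b) := by
  have hPd := natDegree_le_of_eq_C_mul_map (natDegree_num_le f) hP
  have hQd := natDegree_le_of_eq_C_mul_map (natDegree_denom_le f) hQ
  by_cases hb : b = 0
  · subst hb
    have ha : a ≠ 0 := by tauto
    rw [mkPt_zero, formEval_zero_right, formEval_zero_right, mul_comm, mul_comm (Q.coeff _),
      mkPt_mul_mul (pow_ne_zero _ ha)]
    have h1 : P.coeff (ArborealPCF.degree f) = c * algebraMap F L (f.num.coeff (ArborealPCF.degree f)) := by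
      rw [hP, coeff_C_mul, coeff_map]
    have h2 : Q.coeff (ArborealPCF.degree f) = c * algebraMap F L (f.denom.coeff (ArborealPCF.degree f)) := by
      rw [hQ, coeff_C_mul, coeff_map]
    rw [h1, h2, mkPt_mul_mul hc]
    change toMap L f none = _
    simp only [toMap]
    split_ifs with h
    · rw [h, _root_.map_zero, mkPt_zero]
    · rw [mkPt_of_ne _ (by simpa using h), map_div₀]
  · rw [mkPt_of_ne _ hb, formEval_eq_pow_mul_eval hPd a hb, formEval_eq_pow_mul_eval hQd a hb,
      mkPt_mul_mul (pow_ne_zero _ hb)]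
    have h1 : P.eval (a / b) = c * aeval (a / b) f.num := by
      rw [hP, eval_mul, eval_C, eval_map_algebraMap]
    have h2 : Q.eval (a / b) = c * aeval (a / b) f.denom := by
      rw [hQ, eval_mul, eval_C, eval_map_algebraMap]
    rw [h1, h2, mkPt_mul_mul hc]
    change toMap L f (some (a / b)) = _
    simp only [toMap]
    split_ifs with h
    · rw [h, mkPt_zero]
    · rw [mkPt_of_ne _ h]

/-- The critical points are the zeros of the Wronskian form. -/
theorem isCritical_mkPt (hc : c ≠ 0)
    (hP : P = C c * f.num.map (algebraMap F L))
    (hQ : Q = C c * f.denom.map (algebraMap F L)) {a b : L} (hab : a ≠ 0 ∨ b ≠ 0) :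
    IsCritical L f (mkPt a b) ↔
      formEval (2 * ArborealPCF.degree f - 2) (wronskian P Q) a b = 0 := by
  have hPd := natDegree_le_of_eq_C_mul_map (natDegree_num_le f) hP
  have hQd := natDegree_le_of_eq_C_mul_map (natDegree_denom_le f) hQ
  have hc2 : c ^ 2 ≠ 0 := pow_ne_zero _ hc
  by_cases hb : b = 0
  · subst hb
    have ha : a ≠ 0 := by tauto
    rw [mkPt_zero]
    have h1 : formEval (2 * ArborealPCF.degree f - 2) (wronskian P Q) a 0 =
        a ^ (2 * ArborealPCF.degree f - 2) *
          formEval (2 * ArborealPCF.degree f - 2) (wronskian P Q) 1 0 := by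
      rw [← formEval_mul_mul, mul_one, mul_zero]
    have h2 : IsCritical L f OnePoint.infty ↔ (wronskian (reflect (ArborealPCF.degree f) f.num)
      (reflect (ArborealPCF.degree f) f.denom)).eval 0 = 0 := Iff.rfl
    have hr : ∀ u : F[X], reflect (ArborealPCF.degree f) (C c * u.map (algebraMap F L)) =
        C c * (reflect (ArborealPCF.degree f) u).map (algebraMap F L) := fun u => by
      rw [reflect_C_mul]
      congr 1
      ext i
      simp [coeff_reflect]
    rw [h1, formEval_one_left (natDegree_wronskian_le hPd hQd), reflect_wronskian hPd hQd, h2, hP, hQ,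
      hr, hr, wronskian_C_mul_C_mul, ← map_wronskian]
    simp only [eval_neg, eval_mul, eval_C, mul_eq_zero, neg_eq_zero, hc2, false_or,
      pow_ne_zero _ ha]
    rw [← _root_.map_zero (algebraMap F L), eval_map_apply]
    simp
  · rw [mkPt_of_ne _ hb, formEval_eq_pow_mul_eval (natDegree_wronskian_le hPd hQd) a hb, hP, hQ,
      wronskian_C_mul_C_mul, ← map_wronskian, eval_mul, eval_C, eval_map_algebraMap]
    simp only [mul_eq_zero, hc2, pow_ne_zero _ hb, false_or]
    exact Iff.rfl

/-- A pair of polynomials with quotient `f` is a multiple of the pair of numerator and denominator. -/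
theorem exists_mul_num_mul_denom {f : RatFunc F} {P Q : F[X]} (hQ : Q ≠ 0)
    (h : f = algebraMap F[X] (RatFunc F) P / algebraMap F[X] (RatFunc F) Q) :
    ∃ u : F[X], P = u * f.num ∧ Q = u * f.denom := by
  have key : f.num * Q = P * f.denom := by
    have h1 := RatFunc.num_div_denom f
    rw [h] at h1
    conv at h1 => lhs; rw [← h]
    rw [div_eq_div_iff (by simpa using f.denom_ne_zero) (by simpa using hQ), ← _root_.map_mul,
      ← _root_.map_mul] at h1
    exact RatFunc.algebraMap_injective F h1
  obtain ⟨u, hu⟩ : f.denom ∣ Q := f.isCoprime_num_denom.symm.dvd_of_dvd_mul_left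
    (key ▸ dvd_mul_left _ _)
  refine ⟨u, mul_right_cancel₀ f.denom_ne_zero ?_, by rw [hu, mul_comm]⟩
  rw [← key, hu]
  ring

/-- A coprime pair of polynomials with quotient `f` is a constant multiple of the pair of numerator
and denominator. -/
theorem exists_C_mul_num_C_mul_denom {f : RatFunc F} {P Q : F[X]} (hQ : Q ≠ 0) (hPQ : IsCoprime P Q)
    (h : f = algebraMap F[X] (RatFunc F) P / algebraMap F[X] (RatFunc F) Q) :
    ∃ c : F, c ≠ 0 ∧ P = C c * f.num ∧ Q = C c * f.denom := by
  obtain ⟨u, h1, h2⟩ := exists_mul_num_mul_denom hQ h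
  obtain ⟨c, hc, rfl⟩ := Polynomial.isUnit_iff.1
    (hPQ.isUnit_of_dvd' (h1 ▸ dvd_mul_right _ _) (h2 ▸ dvd_mul_right _ _))
  exact ⟨c, hc.ne_zero, h1, h2⟩

/-- If `f` is not a rational function of `x ^ p` and not constant, its Wronskian does not vanish. -/
theorem wronskian_ne_zero_of_hasHeight_zero {g : RatFunc F} (hd : 1 ≤ ArborealPCF.degree g)
    (hg : HasHeight g 0) : wronskian g.num g.denom ≠ 0 := by
  intro h0
  obtain ⟨h1, h2⟩ := g.isCoprime_num_denom.wronskian_eq_zero_iff.1 h0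
  obtain ⟨r, hr⟩ := CharP.exists F
  rcases CharP.char_is_prime_or_zero F r with hp | rfl
  · -- both derivatives vanish, so numerator and denominator are polynomials in `x ^ r`
    have hp0 := hp.ne_zero
    have hmem : 1 ∈ {h : ℕ | ∃ Q : RatFunc F,
        g = algebraMap F[X] (RatFunc F) (expand F (ringChar F ^ h) Q.num) /
        algebraMap F[X] (RatFunc F) (expand F (ringChar F ^ h) Q.denom)} := by
      have hn := expand_contract r h1 hp0
      have hm := expand_contract r h2 hp0
      set N := contract r g.num
      set M := contract r g.denom
      have hM : M ≠ 0 := by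
        intro h
        rw [h, _root_.map_zero] at hm
        exact g.denom_ne_zero hm.symm
      obtain ⟨u, hu1, hu2⟩ := exists_mul_num_mul_denom (P := N) hM rfl
      refine ⟨algebraMap F[X] (RatFunc F) N / algebraMap F[X] (RatFunc F) M, ?_⟩
      set Z := algebraMap F[X] (RatFunc F) N / algebraMap F[X] (RatFunc F) M
      rw [pow_one, ringChar.eq F r]
      have hu : u ≠ 0 := fun h => hM (by rw [hu2, h, zero_mul])
      have hu' : expand F r u ≠ 0 := (expand_ne_zero hp.pos).2 hu
      conv_lhs => rw [← g.num_div_denom, ← hn, ← hm, hu1, hu2]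
      simp only [_root_.map_mul]
      exact mul_div_mul_left _ _ (by simpa using hu')
    exact absurd (hg.2 hmem) (by norm_num)
  · have := CharP.charP_to_charZero F
    rw [ArborealPCF.degree, derivative_eq_zero.1 h1,
      derivative_eq_zero.1 h2] at hd
    simp at hd

end RationalMaps

/-! ### Integral models -/

section IntegralModel

variable {L : Type*} [Field L]

/-- An integral model of a self-map `F` of `ℙ¹(L)` at the place `A`: homogeneous coordinates of `F`
over `A` whose reductions have no common zero. It records the reduction `G` of `F` and the set `C` of
critical points, cut out by the Wronskian, whose reduction is required not to vanish (`G` is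
separable). -/
structure IntegralModel (A : ValuationSubring L) (F : OnePoint L → OnePoint L)
    (G : OnePoint (IsLocalRing.ResidueField A) → OnePoint (IsLocalRing.ResidueField A))
    (C : Set (OnePoint L)) where
  /-- the degree -/
  d : ℕ
  /-- the numerator -/
  p : A[X]
  /-- the denominator -/
  q : A[X]
  one_le : 1 ≤ d
  natDegree_p : p.natDegree ≤ d
  natDegree_q : q.natDegree ≤ d
  isCoprime : IsCoprime (p.map (IsLocalRing.residue A)) (q.map (IsLocalRing.residue A))
  coeff_ne_zero : (p.map (IsLocalRing.residue A)).coeff d ≠ 0 ∨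
    (q.map (IsLocalRing.residue A)).coeff d ≠ 0
  map_mkPt : ∀ a b : A, Unimod a b →
    F (mkPt (a : L) b) = mkPt ((formEval d p a b : A) : L) (formEval d q a b : A)
  red_mkPt : ∀ a b : IsLocalRing.ResidueField A, a ≠ 0 ∨ b ≠ 0 → G (mkPt a b) =
    mkPt (formEval d (p.map (IsLocalRing.residue A)) a b)
      (formEval d (q.map (IsLocalRing.residue A)) a b)
  mem_crit : ∀ a b : A, Unimod a b →
    (mkPt (a : L) b ∈ C ↔ formEval (2 * d - 2) (wronskian p q) a b = 0)
  wronskian_ne_zero : (wronskian p q).map (IsLocalRing.residue A) ≠ 0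

/-- Finitely many elements of `L`, not all zero, can be scaled to be in `A` and not all in the
maximal ideal. -/
theorem exists_scale (A : ValuationSubring L) {ι : Type*} (s : Finset ι) (x : ι → L)
    (h : ∃ i ∈ s, x i ≠ 0) :
    ∃ c : L, c ≠ 0 ∧ (∀ i ∈ s, c * x i ∈ A) ∧ ∃ i ∈ s, A.valuation (c * x i) = 1 := by
  obtain ⟨j, hj, hxj⟩ := h
  obtain ⟨i, hi, hmax⟩ := s.exists_max_image (fun i => A.valuation (x i)) ⟨j, hj⟩
  have hxi : A.valuation (x i) ≠ 0 := by
    intro h0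
    have := hmax j hj
    rw [h0, le_zero_iff, Valuation.zero_iff] at this
    exact hxj this
  have hxi' : x i ≠ 0 := (Valuation.ne_zero_iff _).1 hxi
  refine ⟨(x i)⁻¹, inv_ne_zero hxi', fun k hk => ?_, i, hi, ?_⟩
  · rw [← A.valuation_le_one_iff, _root_.map_mul, map_inv₀, mul_comm, ← div_eq_mul_inv]
    exact div_le_one_of_le₀ (hmax k hk) zero_le
  · rw [inv_mul_cancel₀ hxi', _root_.map_one]

theorem exists_lift_of_coeff_mem (A : ValuationSubring L) (V : L[X]) (h : ∀ i, V.coeff i ∈ A) :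
    ∃ W : A[X], W.map A.subtype = V :=
  (mem_lifts V).1 ((lifts_iff_coeff_lifts V).2 fun n => ⟨⟨V.coeff n, h n⟩, rfl⟩)

/-- A pair of polynomials over `L`, not both zero, has a multiple by a constant which is integral with
nonzero reduction. -/
theorem exists_scale_pair (A : ValuationSubring L) (N M : L[X]) (h : N ≠ 0 ∨ M ≠ 0) :
    ∃ c : L, c ≠ 0 ∧ ∃ n m : A[X], n.map A.subtype = C c * N ∧ m.map A.subtype = C c * M ∧
      (n.map (IsLocalRing.residue A) ≠ 0 ∨ m.map (IsLocalRing.residue A) ≠ 0) := by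
  obtain ⟨c, hc, hint, i, hi, hv⟩ := exists_scale A (N.support.disjSum M.support)
    (Sum.elim N.coeff M.coeff) (by
      rcases h with h | h
      · exact ⟨Sum.inl N.natDegree, by simpa using h, by simpa using h⟩
      · exact ⟨Sum.inr M.natDegree, by simpa using h, by simpa using h⟩)
  obtain ⟨n, hn⟩ := exists_lift_of_coeff_mem A (C c * N) fun i => by
    rw [coeff_C_mul]
    by_cases h0 : N.coeff i = 0
    · rw [h0, mul_zero]; exact A.zero_mem
    · exact hint (Sum.inl i) (by simpa using h0)
  obtain ⟨m, hm⟩ := exists_lift_of_coeff_mem A (C c * M) fun i => by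
    rw [coeff_C_mul]
    by_cases h0 : M.coeff i = 0
    · rw [h0, mul_zero]; exact A.zero_mem
    · exact hint (Sum.inr i) (by simpa using h0)
  refine ⟨c, hc, n, m, hn, hm, ?_⟩
  have key : ∀ (w : A[X]) (W : L[X]) (j : ℕ), w.map A.subtype = C c * W →
      A.valuation (c * W.coeff j) = 1 → w.map (IsLocalRing.residue A) ≠ 0 := by
    intro w W j hw h1 h0
    have h2 : ((w.coeff j : A) : L) = c * W.coeff j := by
      rw [← coeff_C_mul, ← hw, coeff_map]; rfl
    have h3 := congrArg (fun t => t.coeff j) h0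
    simp only [coeff_map, coeff_zero] at h3
    rw [← h2, ← A.valuation_eq_one_iff, ← IsLocalRing.residue_ne_zero_iff_isUnit] at h1
    exact h1 h3
  rcases i with i | i
  · exact Or.inl (key n N i hn hv)
  · exact Or.inr (key m M i hm hv)

/-- Gauss's lemma for a pair: numerator and denominator of `f`, suitably scaled, have coprime
reductions with quotient `g`, whichever integral fraction exhibits the good reduction. -/
theorem exists_primitive_num_denom {K : Type*} [Field K] [NumberField K] [Algebra K L]
    {A : ValuationSubring L} {f : RatFunc K} {g : RatFunc (IsLocalRing.ResidueField A)}
    (hg : IsGoodReduction A f g) :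
    ∃ (c : L) (p q : A[X]), c ≠ 0 ∧ p.map A.subtype = C c * f.num.map (algebraMap K L) ∧
      q.map A.subtype = C c * f.denom.map (algebraMap K L) ∧
      IsCoprime (p.map (IsLocalRing.residue A)) (q.map (IsLocalRing.residue A)) ∧
      q.map (IsLocalRing.residue A) ≠ 0 ∧
      g = algebraMap _ (RatFunc (IsLocalRing.ResidueField A)) (p.map (IsLocalRing.residue A)) /
        algebraMap _ (RatFunc (IsLocalRing.ResidueField A)) (q.map (IsLocalRing.residue A)) := by
  obtain ⟨P, Q, hf, hQ, hcop, hgPQ, -⟩ := hg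
  set ι : NumberField.RingOfIntegers K →+* A :=
    ((algebraMap K L).comp (algebraMap (NumberField.RingOfIntegers K) K)).codRestrict A.toSubring
      (fun a => algebraMap_integer_mem A a) with hι
  have hred : ∀ T : (NumberField.RingOfIntegers K)[X],
      T.map (redInt K A) = (T.map ι).map (IsLocalRing.residue A) := fun T => by
    rw [Polynomial.map_map]; rfl
  have hemb : ∀ T : (NumberField.RingOfIntegers K)[X], (T.map ι).map A.subtype =
      (T.map (algebraMap (NumberField.RingOfIntegers K) K)).map (algebraMap K L) := fun T => by
    rw [Polynomial.map_map, Polynomial.map_map]; rfl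
  rw [hred] at hQ
  rw [hred, hred] at hcop hgPQ
  have hQK : Q.map (algebraMap (NumberField.RingOfIntegers K) K) ≠ 0 := by
    intro h0
    have h1 := hemb Q
    rw [h0, Polynomial.map_zero] at h1
    have h2 : Q.map ι = 0 := Polynomial.map_injective _ A.subtype_injective
      (by rw [h1, Polynomial.map_zero])
    exact hQ (by rw [h2, Polynomial.map_zero])
  obtain ⟨u, hu1, hu2⟩ := exists_mul_num_mul_denom hQK hf
  have hu0 : u ≠ 0 := fun h => hQK (by rw [hu2, h, zero_mul])
  set U := u.map (algebraMap K L) with hU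
  have hU0 : U ≠ 0 := (Polynomial.map_ne_zero_iff (algebraMap K L).injective).2 hu0
  have hD0 : f.denom.map (algebraMap K L) ≠ 0 :=
    (Polynomial.map_ne_zero_iff (algebraMap K L).injective).2 f.denom_ne_zero
  obtain ⟨c, hc, p, q, hp, hq, hpq⟩ :=
    exists_scale_pair A (f.num.map (algebraMap K L)) (f.denom.map (algebraMap K L)) (Or.inr hD0)
  obtain ⟨e, he, w, w', hw, hw', hww⟩ := exists_scale_pair A U 0 (Or.inl hU0)
  have hw0 : w.map (IsLocalRing.residue A) ≠ 0 := by
    refine hww.resolve_right fun h => h ?_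
    have : w' = 0 := Polynomial.map_injective _ A.subtype_injective
      (by rw [hw', mul_zero, Polynomial.map_zero])
    rw [this, Polynomial.map_zero]
  have hP : (w * p).map A.subtype = C (e * c) * (P.map ι).map A.subtype := by
    rw [Polynomial.map_mul, hw, hp, hemb, hu1, Polynomial.map_mul, C_mul]; ring
  have hQ' : (w * q).map A.subtype = C (e * c) * (Q.map ι).map A.subtype := by
    rw [Polynomial.map_mul, hw, hq, hemb, hu2, Polynomial.map_mul, C_mul]; ring
  have hec : e * c ≠ 0 := mul_ne_zero he hc
  -- both pairs are primitive, hence the scaling factor is a unit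
  have hval : A.valuation (e * c) = 1 := by
    refine le_antisymm (not_lt.1 fun hlt => ?_) (not_lt.1 fun hlt => ?_)
    · have hlt' : A.valuation (e * c)⁻¹ < 1 := by
        rw [map_inv₀]; exact inv_lt_one_of_one_lt₀ hlt
      set t : A := ⟨(e * c)⁻¹, (A.valuation_le_one_iff _).1 hlt'.le⟩
      have ht : IsLocalRing.residue A t = 0 := by
        rw [IsLocalRing.residue_eq_zero_iff, A.valuation_lt_one_iff]; exact hlt'
      have h1 : Q.map ι = C t * (w * q) := Polynomial.map_injective _ A.subtype_injective (by
        rw [Polynomial.map_mul, hQ', Polynomial.map_C, ← mul_assoc, ← C_mul]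
        change _ = C ((e * c)⁻¹ * (e * c)) * _
        rw [inv_mul_cancel₀ hec, C_1, one_mul])
      exact hQ (by rw [h1, Polynomial.map_mul, Polynomial.map_C, ht, C_0, zero_mul])
    · set t : A := ⟨e * c, (A.valuation_le_one_iff _).1 hlt.le⟩
      have ht : IsLocalRing.residue A t = 0 := by
        rw [IsLocalRing.residue_eq_zero_iff, A.valuation_lt_one_iff]; exact hlt
      have key : ∀ (r : A[X]) (T : A[X]), (w * r).map A.subtype = C (e * c) * T.map A.subtype →
          r.map (IsLocalRing.residue A) = 0 := fun r T h => by
        have h1 : w * r = C t * T := Polynomial.map_injective _ A.subtype_injective (by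
          rw [h, Polynomial.map_mul, Polynomial.map_C]; rfl)
        have h2 := congrArg (Polynomial.map (IsLocalRing.residue A)) h1
        rw [Polynomial.map_mul, Polynomial.map_mul, Polynomial.map_C, ht, C_0, zero_mul] at h2
        exact (mul_eq_zero.1 h2).resolve_left hw0
      exact hpq.elim (fun h => h (key p _ hP)) fun h => h (key q _ hQ')
  set t : A := ⟨e * c, (A.valuation_le_one_iff _).1 hval.le⟩
  have ht : IsLocalRing.residue A t ≠ 0 := by
    rw [IsLocalRing.residue_ne_zero_iff_isUnit, A.valuation_eq_one_iff]; exact hval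
  have key : ∀ (r : A[X]) (T : A[X]), (w * r).map A.subtype = C (e * c) * T.map A.subtype →
      w.map (IsLocalRing.residue A) * r.map (IsLocalRing.residue A) =
        C (IsLocalRing.residue A t) * T.map (IsLocalRing.residue A) := fun r T h => by
    have h1 : w * r = C t * T := Polynomial.map_injective _ A.subtype_injective (by
      rw [h, Polynomial.map_mul, Polynomial.map_C]; rfl)
    have h2 := congrArg (Polynomial.map (IsLocalRing.residue A)) h1
    rwa [Polynomial.map_mul, Polynomial.map_mul, Polynomial.map_C] at h2
  have kP := key p _ hP
  have kQ := key q _ hQ'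
  have hCt : IsUnit (C (IsLocalRing.residue A t)) := isUnit_C.2 ht.isUnit
  have hcop' : IsCoprime (w.map (IsLocalRing.residue A) * p.map (IsLocalRing.residue A))
      (w.map (IsLocalRing.residue A) * q.map (IsLocalRing.residue A)) := by
    rw [kP, kQ]
    exact (isCoprime_mul_unit_left hCt _ _).2 hcop
  refine ⟨c, p, q, hc, hp, hq, hcop'.of_mul_left_right.of_mul_right_right, ?_, ?_⟩
  · intro h
    rw [h, mul_zero] at kQ
    exact (mul_ne_zero hCt.ne_zero hQ) kQ.symm
  · have h1 := congrArg (algebraMap _ (RatFunc (IsLocalRing.ResidueField A))) kP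
    have h2 := congrArg (algebraMap _ (RatFunc (IsLocalRing.ResidueField A))) kQ
    rw [_root_.map_mul, _root_.map_mul] at h1 h2
    rw [hgPQ, ← mul_div_mul_left _ _ (c := algebraMap _ (RatFunc (IsLocalRing.ResidueField A))
      (C (IsLocalRing.residue A t))) (by simpa using ht), ← h1, ← h2]
    exact mul_div_mul_left _ _ (by simpa using hw0)

/-- A rational function with good reduction of height zero has an integral model. -/
theorem exists_integralModel {K : Type*} [Field K] [NumberField K] [Algebra K L]
    {A : ValuationSubring L} {f : RatFunc K} (hdeg : 1 ≤ ArborealPCF.degree f)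
    {g : RatFunc (IsLocalRing.ResidueField A)} (hg : IsGoodReduction A f g) (hh : HasHeight g 0) :
    Nonempty (IntegralModel A (toMap L f) (toMap (IsLocalRing.ResidueField A) g)
      {x | IsCritical L f x}) := by
  obtain ⟨c, p, q, hc, hp, hq, hcop, hq0, hgpq⟩ := exists_primitive_num_denom hg
  have hgf : ArborealPCF.degree g = ArborealPCF.degree f := by
    obtain ⟨-, -, -, -, -, -, h⟩ := hg
    exact h
  obtain ⟨e, he, h1, h2⟩ := exists_C_mul_num_C_mul_denom hq0 hcop hgpq
  have hnat : ∀ r : A[X], (r.map A.subtype).natDegree = r.natDegree := fun r =>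
    natDegree_map_eq_of_injective A.subtype_injective r
  have hpd : p.natDegree ≤ ArborealPCF.degree f := by
    rw [← hnat]; exact natDegree_le_of_eq_C_mul_map (natDegree_num_le f) hp
  have hqd : q.natDegree ≤ ArborealPCF.degree f := by
    rw [← hnat]; exact natDegree_le_of_eq_C_mul_map (natDegree_denom_le f) hq
  have hcoe : ∀ (D : ℕ) (r : A[X]) (a b : A),
      ((formEval D r a b : A) : L) = formEval D (r.map A.subtype) a b :=
    fun D r a b => map_formEval A.subtype D r a b
  refine ⟨⟨ArborealPCF.degree f, p, q, hdeg, hpd, hqd, hcop, ?_, fun a b hab => ?_, fun a b hab => ?_,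
    fun a b hab => ?_, ?_⟩⟩
  · rw [h1, h2, coeff_C_mul, coeff_C_mul, ← hgf]
    have hmax : (ArborealPCF.degree g = g.num.natDegree ∧ g.num ≠ 0) ∨
        ArborealPCF.degree g = g.denom.natDegree := by
      rcases le_total g.num.natDegree g.denom.natDegree with h | h
      · exact Or.inr (max_eq_right h)
      · refine Or.inl ⟨max_eq_left h, fun h0 => ?_⟩
        have : ArborealPCF.degree g = g.num.natDegree := max_eq_left h
        rw [h0, natDegree_zero] at this
        omega
    rcases hmax with ⟨h, h0⟩ | h
    · left; rw [h]; exact mul_ne_zero he (leadingCoeff_ne_zero.2 h0)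
    · right; rw [h]; exact mul_ne_zero he (leadingCoeff_ne_zero.2 g.denom_ne_zero)
  · rw [hcoe, hcoe]
    exact toMap_mkPt hc hp hq hab.ne_zero
  · rw [← hgf]
    exact toMap_mkPt he (by rw [h1, Algebra.algebraMap_self, Polynomial.map_id])
      (by rw [h2, Algebra.algebraMap_self, Polynomial.map_id]) hab
  · rw [← A.subtype_injective.eq_iff, map_formEval, map_wronskian, _root_.map_zero]
    exact isCritical_mkPt hc hp hq hab.ne_zero
  · rw [map_wronskian, h1, h2, wronskian_C_mul_C_mul]
    refine mul_ne_zero (C_ne_zero.2 (pow_ne_zero _ he))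
      (wronskian_ne_zero_of_hasHeight_zero (by omega) hh)

end IntegralModel

open Function hiding eval

namespace IntegralModel

variable {L : Type*} [Field L] {A : ValuationSubring L} {F : OnePoint L → OnePoint L}
  {G : OnePoint (IsLocalRing.ResidueField A) → OnePoint (IsLocalRing.ResidueField A)}
  {C : Set (OnePoint L)} (M : IntegralModel A F G C)

/-! ### Maps with good reduction and the chordal distance -/

include M

theorem form_residue_ne_zero {a b : IsLocalRing.ResidueField A} (h : a ≠ 0 ∨ b ≠ 0) :
    formEval M.d (M.p.map (IsLocalRing.residue A)) a b ≠ 0 ∨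
      formEval M.d (M.q.map (IsLocalRing.residue A)) a b ≠ 0 := by
  by_cases hb : b = 0
  · subst hb
    have ha : a ≠ 0 := by tauto
    rw [formEval_zero_right, formEval_zero_right]
    exact M.coeff_ne_zero.imp (fun h => mul_ne_zero h (pow_ne_zero _ ha))
      fun h => mul_ne_zero h (pow_ne_zero _ ha)
  · rw [formEval_eq_pow_mul_eval (natDegree_map_le.trans M.natDegree_p) a hb,
      formEval_eq_pow_mul_eval (natDegree_map_le.trans M.natDegree_q) a hb]
    obtain ⟨u, v, huv⟩ := M.isCoprime
    by_contra hcon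
    simp only [ne_eq, mul_eq_zero, pow_ne_zero _ hb, false_or, not_or, not_not] at hcon
    have := congrArg (Polynomial.eval (a / b)) huv
    simp [hcon.1, hcon.2] at this

theorem unimod_form {a b : A} (h : Unimod a b) :
    Unimod (formEval M.d M.p a b) (formEval M.d M.q a b) := by
  rw [unimod_iff_residue, map_formEval, map_formEval]
  exact M.form_residue_ne_zero h.residue_ne_zero

theorem red_map (x : OnePoint L) : red A (F x) = G (red A x) := by
  have h := unimod_coord (A := A) x
  conv_lhs => rw [← mkPt_coord (A := A) x, M.map_mkPt _ _ h, PCFReduction.red_mkPt (M.unimod_form h)]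
  conv_rhs => rw [← mkPt_coord (A := A) x, PCFReduction.red_mkPt h, M.red_mkPt _ _ h.residue_ne_zero]
  rw [map_formEval, map_formEval]

theorem red_iterate (n : ℕ) (x : OnePoint L) : red A (F^[n] x) = G^[n] (red A x) := by
  induction n generalizing x with
  | zero => rfl
  | succ n ih => rw [iterate_succ_apply, iterate_succ_apply, ih, M.red_map]

/-- The value of the Wronskian form at a point. -/
def wval (x : OnePoint L) : A.ValueGroup :=
  A.valuation (formEval (2 * M.d - 2) (wronskian M.p M.q) (coordX A x) (coordY A x) : A)

theorem wval_mkPt {a b : A} (h : Unimod a b) : M.wval (mkPt (a : L) b) =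
    A.valuation (formEval (2 * M.d - 2) (wronskian M.p M.q) a b : A) := by
  obtain ⟨u, h1, h2⟩ := h.exists_unit
  rw [wval]
  generalize mkPt (a : L) b = x at h1 h2 ⊢
  rw [h1, h2, formEval_mul_mul]
  push_cast
  rw [_root_.map_mul, map_pow, A.valuation_unit, one_pow, one_mul]

theorem wval_le_one (x : OnePoint L) : M.wval x ≤ 1 := A.valuation_le_one _

theorem wval_eq_zero_iff {x : OnePoint L} : M.wval x = 0 ↔ x ∈ C := by
  conv_rhs => rw [← mkPt_coord (A := A) x, M.mem_crit _ _ (unimod_coord x)]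
  rw [wval, Valuation.zero_iff, ZeroMemClass.coe_eq_zero]

theorem wval_lt_one_congr {x y : OnePoint L} (h : red A x = red A y) (hx : M.wval x < 1) :
    M.wval y < 1 := by
  have key : ∀ a b a' b' : A, Unimod a b → Unimod a' b' → mkPt (a : L) b = x →
      mkPt (a' : L) b' = y → IsLocalRing.residue A a = IsLocalRing.residue A a' →
      IsLocalRing.residue A b = IsLocalRing.residue A b' → M.wval y < 1 := by
    intro a b a' b' hab hab' h1 h2 ha hb
    rw [← h2, M.wval_mkPt hab', ← A.valuation_lt_one_iff, ← IsLocalRing.residue_eq_zero_iff,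
      map_formEval, ← ha, ← hb, ← map_formEval, IsLocalRing.residue_eq_zero_iff,
      A.valuation_lt_one_iff, ← M.wval_mkPt hab, h1]
    exact hx
  have hres : ∀ a b : A, A.valuation ((a : L) - b) < 1 →
      IsLocalRing.residue A a = IsLocalRing.residue A b := fun a b h => by
    rw [← sub_eq_zero, ← map_sub, IsLocalRing.residue_eq_zero_iff, A.valuation_lt_one_iff]
    exact h
  have hc := chordal_lt_one_iff.2 h
  rcases exists_chart hc with ⟨a, b, rfl, rfl⟩ | ⟨a, b, rfl, rfl⟩
  · rw [chordal_mkPt (Or.inr isUnit_one) (Or.inr isUnit_one)] at hc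
    exact key a 1 b 1 (Or.inr isUnit_one) (Or.inr isUnit_one) rfl rfl
      (hres _ _ (by simpa using hc)) rfl
  · rw [chordal_mkPt (Or.inl isUnit_one) (Or.inl isUnit_one)] at hc
    exact key 1 a 1 b (Or.inl isUnit_one) (Or.inl isUnit_one) rfl rfl rfl
      (hres _ _ (by rw [Valuation.map_sub_swap]; simpa using hc))

omit M in
/-- First order expansion of the determinant of `(P, Q)` at two nearby points of a chart. -/
theorem exists_eval_expansion (P Q : A[X]) (a b : A) :
    ∃ k : A, P.eval a * Q.eval b - P.eval b * Q.eval a =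
      (b - a) * ((wronskian P Q).eval a + (b - a) * k) := by
  obtain ⟨k, hk⟩ := (C (P.eval a) * Q - P * C (Q.eval a)).binomExpansion a (b - a)
  refine ⟨k, ?_⟩
  rw [add_sub_cancel] at hk
  simp only [eval_sub, eval_mul, eval_C, derivative_sub, derivative_mul, derivative_C, zero_mul,
    mul_zero, zero_add, add_zero, wronskian] at hk ⊢
  linear_combination hk

/-- In a residue disc, the factor by which `F` changes chordal distances is approximated by the
Wronskian. -/
theorem chordal_map_map {x y : OnePoint L} (h : chordal A x y < 1) :
    ∃ t k h : A, A.valuation t = M.wval x ∧ A.valuation h = chordal A x y ∧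
      chordal A (F x) (F y) = chordal A x y * A.valuation (t + h * k : A) := by
  have h1 : ∀ a : A, Unimod a 1 := fun a => Or.inr isUnit_one
  have h2 : ∀ a : A, Unimod 1 a := fun a => Or.inl isUnit_one
  rcases exists_chart h with ⟨a, b, rfl, rfl⟩ | ⟨a, b, rfl, rfl⟩
  · obtain ⟨k, hk⟩ := exists_eval_expansion M.p M.q a b
    refine ⟨(wronskian M.p M.q).eval a, k, b - a, ?_, ?_, ?_⟩
    · rw [M.wval_mkPt (h1 a),
        formEval_one_right (natDegree_wronskian_le M.natDegree_p M.natDegree_q)]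
    · rw [chordal_mkPt (h1 a) (h1 b), ← Valuation.map_neg]
      simp
    · rw [M.map_mkPt _ _ (h1 a), M.map_mkPt _ _ (h1 b),
        chordal_mkPt (M.unimod_form (h1 a)) (M.unimod_form (h1 b)), chordal_mkPt (h1 a) (h1 b)]
      simp only [formEval_one_right M.natDegree_p, formEval_one_right M.natDegree_q]
      have := congrArg (Subtype.val : A → L) hk
      push_cast at this ⊢
      rw [this, _root_.map_mul, mul_one, mul_one, Valuation.map_sub_swap A.valuation (a : L)]
  · obtain ⟨k, hk⟩ := exists_eval_expansion (reflect M.d M.p) (reflect M.d M.q) a b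
    refine ⟨(wronskian (reflect M.d M.p) (reflect M.d M.q)).eval a, k, b - a, ?_, ?_, ?_⟩
    · rw [M.wval_mkPt (h2 a),
        formEval_one_left (natDegree_wronskian_le M.natDegree_p M.natDegree_q),
        reflect_wronskian M.natDegree_p M.natDegree_q, eval_neg]
      push_cast
      rw [Valuation.map_neg]
    · rw [chordal_mkPt (h2 a) (h2 b)]
      simp
    · rw [M.map_mkPt _ _ (h2 a), M.map_mkPt _ _ (h2 b),
        chordal_mkPt (M.unimod_form (h2 a)) (M.unimod_form (h2 b)), chordal_mkPt (h2 a) (h2 b)]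
      simp only [formEval_one_left M.natDegree_p, formEval_one_left M.natDegree_q]
      have := congrArg (Subtype.val : A → L) hk
      push_cast at this ⊢
      rw [this, _root_.map_mul, one_mul, one_mul]

theorem chordal_map_le (x y : OnePoint L) : chordal A (F x) (F y) ≤ chordal A x y := by
  rcases (chordal_le_one (A := A) x y).lt_or_eq with h | h
  · obtain ⟨t, k, z, -, -, h3⟩ := M.chordal_map_map h
    rw [h3]
    exact mul_le_of_le_one_right' (A.valuation_le_one _)
  · rw [h]
    exact chordal_le_one _ _

theorem chordal_iterate_le (n : ℕ) (x y : OnePoint L) :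
    chordal A (F^[n] x) (F^[n] y) ≤ chordal A x y := by
  induction n with
  | zero => rfl
  | succ n ih =>
    rw [iterate_succ_apply', iterate_succ_apply']
    exact (M.chordal_map_le _ _).trans ih

theorem chordal_map_eq {x y : OnePoint L} (h : chordal A x y < 1) (hx : ¬ M.wval x < 1) :
    chordal A (F x) (F y) = chordal A x y := by
  obtain ⟨t, k, z, h1, h2, h3⟩ := M.chordal_map_map h
  have ht : A.valuation (t : L) = 1 := by
    rw [h1]; exact le_antisymm (M.wval_le_one x) (not_lt.1 hx)
  have hz : A.valuation ((z : L) * k) < 1 := by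
    rw [_root_.map_mul, h2, mul_comm]
    exact mul_lt_of_le_one_of_lt (A.valuation_le_one k) h
  have : A.valuation ((t + z * k : A) : L) = 1 := by
    push_cast
    rw [Valuation.map_add_eq_of_lt_left _ (by rwa [ht]), ht]
  rw [h3, this, mul_one]

theorem chordal_map_lt {x y : OnePoint L} (h : chordal A x y < 1) (hne : x ≠ y)
    (hx : M.wval x < 1) : chordal A (F x) (F y) < chordal A x y := by
  obtain ⟨t, k, z, h1, h2, h3⟩ := M.chordal_map_map h
  have h0 : chordal A x y ≠ 0 := fun h0 => hne (chordal_eq_zero_iff.1 h0)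
  have hz : A.valuation ((z : L) * k) < 1 := by
    rw [_root_.map_mul, h2, mul_comm]
    exact mul_lt_of_le_one_of_lt (A.valuation_le_one k) h
  have : A.valuation ((t + z * k : A) : L) < 1 := by
    push_cast
    exact (A.valuation.map_add _ _).trans_lt (max_lt (by rwa [h1]) hz)
  rw [h3]
  exact mul_lt_of_lt_one_right (zero_lt_iff.2 h0) this

/-- Two points with the same image are separated by the value of the Wronskian. -/
theorem wval_le_chordal {x y : OnePoint L} (hne : x ≠ y) (hF : F x = F y) :
    M.wval x ≤ chordal A x y := by
  rcases (chordal_le_one (A := A) x y).lt_or_eq with h | h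
  · obtain ⟨t, k, z, h1, h2, h3⟩ := M.chordal_map_map h
    have h0 : chordal A x y ≠ 0 := fun h0 => hne (chordal_eq_zero_iff.1 h0)
    rw [hF, chordal_self, eq_comm, mul_eq_zero, or_iff_right h0, Valuation.zero_iff] at h3
    push_cast at h3
    rw [← h1, eq_neg_of_add_eq_zero_left h3, Valuation.map_neg, _root_.map_mul, h2]
    exact mul_le_of_le_one_right' (A.valuation_le_one k)
  · rw [h]
    exact M.wval_le_one x

/-- An iterate of `F` is a strict contraction on a residue disc whose orbit meets the critical set. -/
theorem chordal_iterate_lt {x y : OnePoint L} (h : chordal A x y < 1) (hne : x ≠ y) {i n : ℕ}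
    (hi : i < n) (hx : M.wval (F^[i] x) < 1) : chordal A (F^[n] x) (F^[n] y) < chordal A x y := by
  obtain ⟨m, rfl⟩ := Nat.exists_eq_add_of_lt hi
  rw [show i + m + 1 = m + (i + 1) by ring, iterate_add_apply, iterate_add_apply F m]
  refine (M.chordal_iterate_le m _ _).trans_lt ?_
  rw [iterate_succ_apply', iterate_succ_apply']
  by_cases hii : F^[i] x = F^[i] y
  · rw [hii, chordal_self]
    exact zero_lt_iff.2 fun h0 => hne (chordal_eq_zero_iff.1 h0)
  · exact (M.chordal_map_lt ((M.chordal_iterate_le i x y).trans_lt h) hii hx).trans_le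
      (M.chordal_iterate_le i x y)

/-- A residue disc which meets the critical set contains at most one periodic point, because a power of
`F` that fixes two of them would be a strict contraction. -/
theorem eq_of_mem_periodicPts {x y : OnePoint L} (hx : x ∈ periodicPts F) (hy : y ∈ periodicPts F)
    (h : red A x = red A y) (hw : M.wval x < 1) : x = y := by
  obtain ⟨n, hn, hnx⟩ := hx
  obtain ⟨m, hm, hmy⟩ := hy
  by_contra hne
  have h1 : F^[n * m] x = x := hnx.mul_const m
  have h2 : F^[n * m] y = y := hmy.const_mul n
  have := M.chordal_iterate_lt (i := 0) (chordal_lt_one_iff.2 h) hne (Nat.mul_pos hn hm) hw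
  rw [h1, h2] at this
  exact lt_irrefl _ this

/-! ### Critical points and fibres -/

section AlgClosed

variable [IsAlgClosed L]

/-- The value of the Wronskian is the product of the distances to the critical points. -/
theorem exists_wval_eq_prod : ∃ s : Multiset (OnePoint L), (∀ x, x ∈ s ↔ x ∈ C) ∧
    ∀ x, M.wval x = (s.map fun c => chordal A c x).prod := by
  obtain ⟨s, -, hs⟩ := exists_valuation_formEval_eq_prod
    (natDegree_wronskian_le M.natDegree_p M.natDegree_q) M.wronskian_ne_zero
  have key : ∀ x, M.wval x = (s.map fun c => chordal A c x).prod := fun x => by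
    rw [wval, hs _ _ (unimod_coord x), mkPt_coord]
  refine ⟨s, fun x => ?_, key⟩
  rw [← M.wval_eq_zero_iff, key, Multiset.prod_eq_zero_iff, Multiset.mem_map]
  constructor
  · exact fun hx => ⟨x, hx, chordal_self x⟩
  · rintro ⟨c, hc, h⟩
    rwa [← chordal_eq_zero_iff.1 h]

theorem finite_crit : C.Finite := by
  classical
  obtain ⟨s, hs, -⟩ := M.exists_wval_eq_prod
  exact s.toFinset.finite_toSet.subset fun x hx => by simpa using (hs x).2 hx

omit M [IsAlgClosed L] in
theorem exists_lt_one_of_prod_lt {s : Multiset (OnePoint L)} {x : OnePoint L} {ε : A.ValueGroup}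
    (h : (s.map fun c => chordal A c x).prod < ε ^ s.card) : ∃ c ∈ s, chordal A c x < ε := by
  by_contra! hcon
  refine absurd h (not_lt.2 ?_)
  clear h
  induction s using Multiset.induction with
  | empty => simp
  | cons a s ih =>
    rw [Multiset.card_cons, Multiset.map_cons, Multiset.prod_cons, pow_succ, mul_comm]
    exact mul_le_mul' (hcon a (Multiset.mem_cons_self a s))
      (ih fun c hc => hcon c (Multiset.mem_cons_of_mem hc))

theorem exists_crit_of_wval_lt_one {x : OnePoint L} (h : M.wval x < 1) :
    ∃ c ∈ C, red A c = red A x := by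
  obtain ⟨s, hs, hw⟩ := M.exists_wval_eq_prod
  rw [hw, ← one_pow s.card] at h
  obtain ⟨c, hc, hlt⟩ := exists_lt_one_of_prod_lt h
  exact ⟨c, (hs c).1 hc, chordal_lt_one_iff.1 hlt⟩

omit [IsAlgClosed L] in
theorem wval_lt_one_of_crit {c x : OnePoint L} (hc : c ∈ C) (h : red A c = red A x) :
    M.wval x < 1 :=
  M.wval_lt_one_congr h (by rw [M.wval_eq_zero_iff.2 hc]; exact zero_lt_one)

/-- The fibre over `y`, with multiplicities, determines the distance of `F x` from `y`. -/
theorem exists_fibre (y : OnePoint L) : ∃ s : Multiset (OnePoint L), s.card = M.d ∧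
    (∀ x, x ∈ s ↔ F x = y) ∧ ∀ x, chordal A (F x) y = (s.map fun c => chordal A c x).prod := by
  set X' := coordX A y
  set Y' := coordY A y
  have hXY : Unimod X' Y' := unimod_coord y
  have hdeg : (Polynomial.C Y' * M.p - Polynomial.C X' * M.q).natDegree ≤ M.d :=
    (natDegree_sub_le _ _).trans (max_le ((natDegree_C_mul_le _ _).trans M.natDegree_p)
      ((natDegree_C_mul_le _ _).trans M.natDegree_q))
  have hred : (Polynomial.C Y' * M.p - Polynomial.C X' * M.q).map (IsLocalRing.residue A) ≠ 0 := by
    intro h0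
    simp only [Polynomial.map_sub, Polynomial.map_mul, Polynomial.map_C] at h0
    set P := M.p.map (IsLocalRing.residue A)
    set Q := M.q.map (IsLocalRing.residue A)
    set u := IsLocalRing.residue A X'
    set v := IsLocalRing.residue A Y'
    have huv : u ≠ 0 ∨ v ≠ 0 := hXY.residue_ne_zero
    rw [sub_eq_zero] at h0
    -- both reductions would be constant, against the coefficient of degree `d ≥ 1`
    have hdP : P ∣ Polynomial.C u := by
      refine M.isCoprime.dvd_of_dvd_mul_right ?_
      rw [← h0]; exact dvd_mul_left _ _
    have hdQ : Q ∣ Polynomial.C v := by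
      refine M.isCoprime.symm.dvd_of_dvd_mul_right ?_
      rw [h0]; exact dvd_mul_left _ _
    have hcst : ∀ T : (IsLocalRing.ResidueField A)[X], ∀ w : IsLocalRing.ResidueField A, w ≠ 0 →
        T ∣ Polynomial.C w → T.coeff M.d = 0 := fun T w hw h => by
      have := natDegree_le_of_dvd h (C_ne_zero.2 hw)
      rw [natDegree_C] at this
      exact coeff_eq_zero_of_natDegree_lt (by have := M.one_le; omega)
    have hcoef : v * P.coeff M.d = u * Q.coeff M.d := by
      have := congrArg (fun T => T.coeff M.d) h0
      simpa only [coeff_C_mul] using this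
    rcases eq_or_ne u 0 with hu | hu
    · have hv := huv.resolve_left (not_not.2 hu)
      rw [hcst Q v hv hdQ, mul_zero] at hcoef
      exact M.coeff_ne_zero.elim (fun h => h ((mul_eq_zero.1 hcoef).resolve_left hv))
        fun h => h (hcst Q v hv hdQ)
    · rw [hcst P u hu hdP, mul_zero] at hcoef
      exact M.coeff_ne_zero.elim (fun h => h (hcst P u hu hdP))
        fun h => h ((mul_eq_zero.1 hcoef.symm).resolve_left hu)
  obtain ⟨s, hcard, hs⟩ := exists_valuation_formEval_eq_prod hdeg hred
  have key : ∀ x, chordal A (F x) y = (s.map fun c => chordal A c x).prod := fun x => by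
    have hx := unimod_coord (A := A) x
    have h1 := hs _ _ hx
    rw [mkPt_coord] at h1
    rw [← h1]
    conv_lhs => rw [← mkPt_coord (A := A) x, ← mkPt_coord (A := A) y, M.map_mkPt _ _ hx,
      chordal_mkPt (M.unimod_form hx) (unimod_coord y)]
    rw [formEval_sub, formEval_C_mul, formEval_C_mul]
    congr 1
    push_cast
    ring
  refine ⟨s, hcard, fun x => ?_, key⟩
  rw [← chordal_eq_zero_iff (A := A), key, Multiset.prod_eq_zero_iff, Multiset.mem_map]
  constructor
  · exact fun hx => ⟨x, hx, chordal_self x⟩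
  · rintro ⟨c, hc, h⟩
    rwa [← chordal_eq_zero_iff.1 h]

theorem finite_preimage {S : Set (OnePoint L)} (hS : S.Finite) : (F ⁻¹' S).Finite := by
  classical
  refine Set.Finite.preimage' hS fun y _ => ?_
  obtain ⟨s, -, hs, -⟩ := M.exists_fibre y
  exact s.toFinset.finite_toSet.subset fun x hx => by simpa using (hs x).2 hx

/-- If `F x` is close to `y`, then `x` is close to the fibre over `y`. -/
theorem exists_preimage_near {x y : OnePoint L} {ε : A.ValueGroup}
    (h : chordal A (F x) y < ε ^ M.d) : ∃ c, F c = y ∧ chordal A c x < ε := by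
  obtain ⟨s, hcard, hs, hprod⟩ := M.exists_fibre y
  rw [hprod, ← hcard] at h
  obtain ⟨c, hc, hlt⟩ := exists_lt_one_of_prod_lt h
  exact ⟨c, (hs c).1 hc, hlt⟩

/-- Preimages under an iterate can be chosen in any residue disc mapping to the right one. -/
theorem exists_iterate_eq_of_red (n : ℕ) {x y : OnePoint L} (h : red A (F^[n] x) = red A y) :
    ∃ c, F^[n] c = y ∧ red A c = red A x := by
  induction n generalizing y with
  | zero => exact ⟨y, rfl, h.symm⟩
  | succ n ih =>
    rw [iterate_succ_apply'] at h
    obtain ⟨z, hz, hzx⟩ := M.exists_preimage_near (ε := 1) (x := F^[n] x) (y := y)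
      (by rw [one_pow]; exact chordal_lt_one_iff.2 h)
    obtain ⟨c, hc, hcx⟩ := ih (y := z) (chordal_lt_one_iff.1 hzx).symm
    exact ⟨c, by rw [iterate_succ_apply', hc, hz], hcx⟩

/-! ### Symmetries in the inertia group -/

omit M [IsAlgClosed L] in
variable (A F) in
/-- What is used of the action of an element of the inertia group on `ℙ¹(L)`: it is an isometry,
preserves residue discs and commutes with `F`. -/
structure _root_.PCFReduction.IsInertial (σ : OnePoint L → OnePoint L) : Prop where
  chordal_eq : ∀ x y, chordal A (σ x) (σ y) = chordal A x y
  red_eq : ∀ x, red A (σ x) = red A x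
  map_comm : ∀ x, F (σ x) = σ (F x)

omit [IsAlgClosed L] in
/-- Outside the critical discs, `F` is injective on residue discs, so that inertia fixes the points over
a fixed point. -/
theorem fixed_of_noncritical {σ : OnePoint L → OnePoint L} (hσ : IsInertial A F σ) {x : OnePoint L}
    (hx : ¬ M.wval x < 1) (h : σ (F x) = F x) : σ x = x := by
  have h1 := M.chordal_map_eq (chordal_lt_one_iff.2 (hσ.red_eq x).symm) hx
  rw [hσ.map_comm, h, chordal_self] at h1
  exact (chordal_eq_zero_iff.1 h1.symm).symm

omit M [IsAlgClosed L] in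
variable (A F) in
/-- The set `Y` is totally bounded, and fixed pointwise by all elements of the inertia group which fix
some finite set of points. -/
def _root_.PCFReduction.Tame (Y : Set (OnePoint L)) : Prop :=
  (∀ ε : A.ValueGroup, ε ≠ 0 → ∃ S : Set (OnePoint L), S.Finite ∧ ∀ y ∈ Y, ∃ s ∈ S, chordal A y s < ε) ∧
  ∃ T : Set (OnePoint L), T.Finite ∧
    ∀ σ, IsInertial A F σ → (∀ t ∈ T, σ t = t) → ∀ y ∈ Y, σ y = y

omit M [IsAlgClosed L] in
theorem _root_.PCFReduction.Tame.of_finite {Y : Set (OnePoint L)} (hY : Y.Finite) : Tame A F Y :=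
  ⟨fun ε hε => ⟨Y, hY, fun y hy => ⟨y, hy, by rw [chordal_self]; exact zero_lt_iff.2 hε⟩⟩,
    Y, hY, fun _ _ h => h⟩

/-- Krasner's lemma for the fibres over a totally bounded set: if the fibres over `Y` are uniformly
separated, finitely many of them control the others. -/
theorem tame_preimage {Y : Set (OnePoint L)} (hY : Tame A F Y) {η : A.ValueGroup} (hη : η ≠ 0)
    (hsep : ∀ x ∈ F ⁻¹' Y, η ≤ M.wval x) : Tame A F (F ⁻¹' Y) := by
  obtain ⟨htb, T, hT, hfix⟩ := hY
  have key : ∀ ε : A.ValueGroup, ε ≠ 0 → ∃ S : Set (OnePoint L), S.Finite ∧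
      ∀ x ∈ F ⁻¹' Y, ∃ s ∈ S, chordal A x s < ε := by
    intro ε hε
    obtain ⟨S, hS, h⟩ := htb (ε ^ M.d) (pow_ne_zero _ hε)
    refine ⟨F ⁻¹' S, M.finite_preimage hS, fun x hx => ?_⟩
    obtain ⟨s, hs, hlt⟩ := h (F x) hx
    obtain ⟨c, hc, hcx⟩ := M.exists_preimage_near hlt
    exact ⟨c, by rwa [Set.mem_preimage, hc], by rwa [chordal_comm]⟩
  refine ⟨key, ?_⟩
  obtain ⟨S, hS, h⟩ := key η hη
  refine ⟨T ∪ S, hT.union hS, fun σ hσ hTS x hx => ?_⟩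
  have hFx : σ (F x) = F x := hfix σ hσ (fun t ht => hTS t (Or.inl ht)) _ hx
  obtain ⟨s, hs, hlt⟩ := h x hx
  have hσs : σ s = s := hTS s (Or.inr hs)
  by_contra hne
  have h1 : chordal A (σ x) s < η := by rwa [← hσs, hσ.chordal_eq]
  rw [chordal_comm] at h1
  exact absurd (M.wval_le_chordal (Ne.symm hne) (by rw [hσ.map_comm, hFx]))
    (not_le.2 ((chordal_lt_of_lt hlt h1).trans_le (hsep x hx)))

end AlgClosed

end IntegralModel

namespace IntegralModel

variable {L : Type*} [Field L] {A : ValuationSubring L} {F : OnePoint L → OnePoint L}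
  {G : OnePoint (IsLocalRing.ResidueField A) → OnePoint (IsLocalRing.ResidueField A)}
  {C : Set (OnePoint L)} (M : IntegralModel A F G C)

/-! ### Backward orbits avoiding the periodic critical discs -/

variable (A G) in
/-- The points whose reduction is periodic and has `b` in its orbit. -/
def cycleDiscs (b : OnePoint (IsLocalRing.ResidueField A)) : Set (OnePoint L) :=
  {x | red A x ∈ periodicPts G ∧ ∃ m, G^[m] (red A x) = b}

include M

variable {α : OnePoint L}

theorem map_mem_cycleDiscs {b : OnePoint (IsLocalRing.ResidueField A)} {x : OnePoint L}
    (hx : x ∈ cycleDiscs A G b) : F x ∈ cycleDiscs A G b := by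
  obtain ⟨⟨n, hn, hnx⟩, m, hm⟩ := hx
  refine ⟨⟨n, hn, ?_⟩, m + n - 1, ?_⟩
  · rw [M.red_map]
    exact hnx.map (fun _ => rfl)
  · rw [M.red_map, ← iterate_succ_apply, show (m + n - 1).succ = m + n by omega, iterate_add_apply,
      hnx.eq, hm]

theorem iterate_mem_cycleDiscs {b : OnePoint (IsLocalRing.ResidueField A)} {x : OnePoint L}
    (hx : x ∈ cycleDiscs A G b) (n : ℕ) : F^[n] x ∈ cycleDiscs A G b := by
  induction n with
  | zero => exact hx
  | succ n ih =>
    rw [iterate_succ_apply']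
    exact M.map_mem_cycleDiscs ih

theorem mem_cycleDiscs_of_iterate {x : OnePoint L} {n : ℕ} (hn : F^[n] x = α)
    (hx : red A x ∈ periodicPts G) : x ∈ cycleDiscs A G (red A α) :=
  ⟨hx, n, by rw [← M.red_iterate, hn]⟩

variable [IsAlgClosed L]

variable {b : OnePoint (IsLocalRing.ResidueField A)}

/-- On a cycle of residue discs without critical points, `F` is an isometry. -/
theorem chordal_map_of_mem_cycleDiscs
    (H : ∀ c ∈ C, c ∉ cycleDiscs A G b) {x y : OnePoint L}
    (hx : x ∈ cycleDiscs A G b) (hy : y ∈ cycleDiscs A G b) :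
    chordal A (F x) (F y) = chordal A x y := by
  rcases (chordal_le_one (A := A) x y).lt_or_eq with h | h
  · refine M.chordal_map_eq h fun hw => ?_
    obtain ⟨c, hc, hcx⟩ := M.exists_crit_of_wval_lt_one hw
    refine H c hc ?_
    rw [cycleDiscs, Set.mem_ofPred_eq, hcx]
    exact hx
  · rw [h]
    refine le_antisymm (chordal_le_one _ _) (not_lt.1 fun hlt => ?_)
    rw [chordal_lt_one_iff, M.red_map, M.red_map] at hlt
    have := (bijOn_periodicPts G).injOn hx.1 hy.1 hlt
    exact absurd (chordal_lt_one_iff.2 this) (by rw [h]; exact lt_irrefl _)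

theorem chordal_iterate_of_mem_cycleDiscs
    (H : ∀ c ∈ C, c ∉ cycleDiscs A G b) {x y : OnePoint L}
    (hx : x ∈ cycleDiscs A G b) (hy : y ∈ cycleDiscs A G b) (n : ℕ) :
    chordal A (F^[n] x) (F^[n] y) = chordal A x y := by
  induction n with
  | zero => rfl
  | succ n ih =>
    rw [iterate_succ_apply', iterate_succ_apply', M.chordal_map_of_mem_cycleDiscs H
      (M.iterate_mem_cycleDiscs hx n) (M.iterate_mem_cycleDiscs hy n), ih]

variable (A F G α) in
omit M [IsAlgClosed L] in
/-- The points of the backward orbit of `α` whose reduction is periodic or equal to that of `α`. -/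
def periodicTree : Set (OnePoint L) :=
  {x | (∃ n, F^[n] x = α) ∧ (red A x = red A α ∨ red A x ∈ periodicPts G)}

omit [IsAlgClosed L] in
theorem mem_cycleDiscs_of_mem_periodicTree (hα : red A α ∈ periodicPts G) {x : OnePoint L}
    (hx : x ∈ periodicTree A F G α) : x ∈ cycleDiscs A G (red A α) := by
  obtain ⟨⟨n, hn⟩, h⟩ := hx
  exact M.mem_cycleDiscs_of_iterate hn (h.elim (fun h => h ▸ hα) id)

omit [IsAlgClosed L] in
theorem eq_of_mem_periodicTree (hα : red A α ∉ periodicPts G) {x : OnePoint L}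
    (hx : x ∈ periodicTree A F G α) : x = α := by
  obtain ⟨⟨n, hn⟩, h⟩ := hx
  have hn' : G^[n] (red A x) = red A α := by rw [← M.red_iterate, hn]
  rcases h with h | ⟨m, hm, hmx⟩
  · rcases Nat.eq_zero_or_pos n with rfl | hpos
    · exact hn
    · rw [h] at hn'
      exact absurd ⟨n, hpos, hn'⟩ hα
  · refine absurd ⟨m, hm, ?_⟩ hα
    rw [← hn']
    exact hmx.map (Function.Commute.iterate_left (Function.Commute.refl G) n).semiconj

/-- If the discs over the cycle of `α` contain no critical point, inertia fixes `periodicTree`. -/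
theorem fixed_of_mem_periodicTree (H : ∀ c ∈ C, c ∉ cycleDiscs A G (red A α))
    {σ : OnePoint L → OnePoint L} (hσ : IsInertial A F σ) (hσα : σ α = α) {x : OnePoint L}
    (hx : x ∈ periodicTree A F G α) : σ x = x := by
  by_cases hα : red A α ∈ periodicPts G
  · have hD := M.mem_cycleDiscs_of_mem_periodicTree hα hx
    obtain ⟨⟨n, hn⟩, -⟩ := hx
    clear hα
    induction n generalizing x with
    | zero =>
      have : x = α := hn
      rw [this, hσα]
    | succ n ih =>
      refine M.fixed_of_noncritical hσ (fun hw => ?_) (ih (M.map_mem_cycleDiscs hD) hn)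
      obtain ⟨c, hc, hcx⟩ := M.exists_crit_of_wval_lt_one hw
      refine H c hc ?_
      rw [cycleDiscs, Set.mem_ofPred_eq, hcx]
      exact hD
  · rw [M.eq_of_mem_periodicTree hα hx, hσα]

/-- If `α` has a finite orbit, all points of its backward orbit in its own cycle of residue discs are
in this orbit. -/
theorem finite_periodicTree_of_finite_orbit (H : ∀ c ∈ C, c ∉ cycleDiscs A G (red A α))
    (hfin : (Set.range fun n : ℕ => F^[n] α).Finite) : (periodicTree A F G α).Finite := by
  by_cases hα : red A α ∈ periodicPts G
  · have hαD : α ∈ cycleDiscs A G (red A α) := ⟨hα, 0, rfl⟩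
    have : Finite (Set.range fun n : ℕ => F^[n] α) := hfin
    obtain ⟨a, b, hab, heq⟩ := Finite.exists_ne_map_eq_of_infinite
      (Set.rangeFactorization fun n : ℕ => F^[n] α)
    replace heq : F^[a] α = F^[b] α := congrArg Subtype.val heq
    wlog hlt : a < b generalizing a b
    · exact this b a hab.symm heq.symm (by omega)
    obtain ⟨m, rfl⟩ := Nat.exists_eq_add_of_lt hlt
    have hper : F^[m + 1] α = α := by
      rw [← chordal_eq_zero_iff (A := A), ← M.chordal_iterate_of_mem_cycleDiscs H
        (M.iterate_mem_cycleDiscs hαD _) hαD a, ← iterate_add_apply, heq]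
      exact chordal_self _
    refine hfin.subset fun x hx => ?_
    have hxD := M.mem_cycleDiscs_of_mem_periodicTree hα hx
    obtain ⟨⟨n, hn⟩, -⟩ := hx
    refine ⟨n * m, ?_⟩
    rw [← chordal_eq_zero_iff (A := A), ← M.chordal_iterate_of_mem_cycleDiscs H
      (M.iterate_mem_cycleDiscs hαD _) hxD n, ← iterate_add_apply, hn, chordal_eq_zero_iff,
      show n + n * m = (m + 1) * n by ring, iterate_mul, iterate_fixed hper]
  · exact (Set.finite_singleton α).subset fun x hx => M.eq_of_mem_periodicTree hα hx

/-- If the forward orbit of `α` has near returns, the part of its backward orbit in its own cycle of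
residue discs is approximated by the forward orbit. -/
theorem tame_periodicTree (H : ∀ c ∈ C, c ∉ cycleDiscs A G (red A α))
    (hrec : ∀ ε : A.ValueGroup, ε ≠ 0 → ∃ i j : ℕ, i < j ∧ chordal A (F^[i] α) (F^[j] α) < ε) :
    Tame A F (periodicTree A F G α) := by
  refine ⟨fun ε hε => ?_, {α}, Set.finite_singleton α, fun σ hσ h x hx =>
    M.fixed_of_mem_periodicTree H hσ (h α rfl) hx⟩
  by_cases hα : red A α ∈ periodicPts G
  · have hαD : α ∈ cycleDiscs A G (red A α) := ⟨hα, 0, rfl⟩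
    have hit := fun n => M.iterate_mem_cycleDiscs hαD n
    obtain ⟨i, j, hij, hlt⟩ := hrec ε hε
    obtain ⟨m, rfl⟩ := Nat.exists_eq_add_of_lt hij
    set l := m + 1 with hl
    rw [add_assoc, iterate_add_apply, M.chordal_iterate_of_mem_cycleDiscs H hαD (hit _)] at hlt
    have hret : ∀ k, chordal A (F^[k * l] α) α < ε := by
      intro k
      induction k with
      | zero => rw [zero_mul]; exact (chordal_self (A := A) α).trans_lt (zero_lt_iff.2 hε)
      | succ k ih =>
        refine chordal_lt_of_lt (y := F^[l] α) ?_ (by rwa [chordal_comm])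
        rw [Nat.succ_mul, add_comm, iterate_add_apply,
          M.chordal_iterate_of_mem_cycleDiscs H (hit _) hαD]
        exact ih
    refine ⟨(fun r => F^[r] α) '' Set.Iio l, (Set.finite_Iio l).image _, fun x hx => ?_⟩
    have hxD := M.mem_cycleDiscs_of_mem_periodicTree hα hx
    obtain ⟨⟨n, hn⟩, -⟩ := hx
    refine ⟨_, ⟨(n * m) % l, Nat.mod_lt _ (by omega), rfl⟩, ?_⟩
    refine chordal_lt_of_lt (y := F^[n * m] α) ?_ ?_
    · rw [← M.chordal_iterate_of_mem_cycleDiscs H hxD (hit _) n, ← iterate_add_apply, hn,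
        show n + n * m = n * l by rw [hl]; ring, chordal_comm]
      exact hret n
    · have hsplit : F^[n * m] α = F^[n * m % l] (F^[n * m / l * l] α) := by
        rw [← iterate_add_apply, mul_comm (n * m / l), Nat.mod_add_div]
      rw [hsplit]
      change chordal A _ (F^[n * m % l] α) < ε
      rw [M.chordal_iterate_of_mem_cycleDiscs H (hit _) hαD]
      exact hret _
  · exact ⟨{α}, Set.finite_singleton α, fun x hx => ⟨α, rfl, by
      rw [M.eq_of_mem_periodicTree hα hx, chordal_self]; exact zero_lt_iff.2 hε⟩⟩

/-- Unless `α` is postcritical, the Wronskian is bounded below on the backward orbit of `α`: a point of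
it is at least as far from a critical point as `α` is from the postcritical set, which is finite. -/
theorem exists_le_wval (hpcf : ∀ c ∈ C, (Set.range fun n : ℕ => F^[n] c).Finite)
    (hα : ∀ c ∈ C, ∀ n, F^[n] c ≠ α) :
    ∃ η : A.ValueGroup, η ≠ 0 ∧ ∀ x n, F^[n + 1] x = α → η ≤ M.wval x := by
  obtain ⟨s, hs, hw⟩ := M.exists_wval_eq_prod
  have hfin : (⋃ c ∈ C, Set.range fun n : ℕ => F^[n] c).Finite := M.finite_crit.biUnion hpcf
  obtain ⟨η, hη, hle⟩ : ∃ η : A.ValueGroup, η ≠ 0 ∧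
      ∀ c ∈ C, ∀ n : ℕ, η ≤ chordal A (F^[n] c) α := by
    rcases (⋃ c ∈ C, Set.range fun n : ℕ => F^[n] c).eq_empty_or_nonempty with h | h
    · refine ⟨1, one_ne_zero, fun c hc n => ?_⟩
      have : F^[n] c ∈ (⋃ c ∈ C, Set.range fun n : ℕ => F^[n] c) := by
        simp only [Set.mem_iUnion]
        exact ⟨c, hc, n, rfl⟩
      rw [h] at this
      exact absurd this (Set.notMem_empty _)
    · obtain ⟨z, hz, hmin⟩ := Set.exists_min_image _ (fun z => chordal A z α) hfin h
      refine ⟨chordal A z α, fun h0 => ?_, fun c hc n => hmin _ ?_⟩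
      · simp only [Set.mem_iUnion] at hz
        obtain ⟨c, hc, n, rfl⟩ := hz
        exact hα c hc n (chordal_eq_zero_iff.1 h0)
      · simp only [Set.mem_iUnion]
        exact ⟨c, hc, n, rfl⟩
  refine ⟨η ^ s.card, pow_ne_zero _ hη, fun x n hx => ?_⟩
  rw [hw]
  have hall : ∀ c ∈ s, η ≤ chordal A c x := fun c hc => by
    refine (hle c ((hs c).1 hc) (n + 1)).trans ?_
    rw [← hx]
    exact M.chordal_iterate_le _ _ _
  clear hw hs
  induction s using Multiset.induction with
  | empty => simp
  | cons a s ih =>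
    rw [Multiset.card_cons, Multiset.map_cons, Multiset.prod_cons, pow_succ, mul_comm]
    exact mul_le_mul' (hall a (Multiset.mem_cons_self a s))
      (ih fun c hc => hall c (Multiset.mem_cons_of_mem hc))

/-- The points of the tree which reach `periodicTree` in `m` steps are under control. -/
theorem tame_preimage_periodicTree (H : ∀ c ∈ C, c ∉ cycleDiscs A G (red A α))
    (hpcf : ∀ c ∈ C, (Set.range fun n : ℕ => F^[n] c).Finite)
    (hrec : ∀ ε : A.ValueGroup, ε ≠ 0 → ∃ i j : ℕ, i < j ∧ chordal A (F^[i] α) (F^[j] α) < ε)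
    (m : ℕ) : Tame A F (F^[m] ⁻¹' periodicTree A F G α) := by
  by_cases hα : ∃ c ∈ C, ∃ n, F^[n] c = α
  · obtain ⟨c, hc, n, rfl⟩ := hα
    have h1 : (periodicTree A F G (F^[n] c)).Finite := by
      refine M.finite_periodicTree_of_finite_orbit H ((hpcf c hc).subset ?_)
      rintro _ ⟨k, rfl⟩
      exact ⟨k + n, iterate_add_apply _ _ _ _⟩
    refine Tame.of_finite ?_
    induction m with
    | zero => exact h1
    | succ m ih =>
      rw [iterate_succ, Set.preimage_comp]
      exact M.finite_preimage ih
  · push Not at hα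
    obtain ⟨η, hη, hsep⟩ := M.exists_le_wval hpcf hα
    induction m with
    | zero => exact M.tame_periodicTree H hrec
    | succ m ih =>
      rw [iterate_succ, Set.preimage_comp]
      refine M.tame_preimage ih hη fun x hx => ?_
      obtain ⟨⟨n, hn⟩, -⟩ := hx
      refine hsep x (n + m) ?_
      rw [iterate_succ_apply, iterate_add_apply]
      exact hn

/-- If `α` is not in the cycle of a periodic critical residue disc, its backward orbit is fixed pointwise
by all elements of the inertia group fixing some finite set. -/
theorem exists_finite_fixing_tree (H : ∀ c ∈ C, c ∉ cycleDiscs A G (red A α))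
    (hpcf : ∀ c ∈ C, (Set.range fun n : ℕ => F^[n] c).Finite)
    (hrec : ∀ ε : A.ValueGroup, ε ≠ 0 → ∃ i j : ℕ, i < j ∧ chordal A (F^[i] α) (F^[j] α) < ε) :
    ∃ T : Set (OnePoint L), T.Finite ∧ ∀ σ, IsInertial A F σ → (∀ t ∈ T, σ t = t) →
      ∀ n x, F^[n] x = α → σ x = x := by
  classical
  choose _ T hT hfix using fun m => M.tame_preimage_periodicTree H hpcf hrec m
  -- a critical disc meets the tree in few steps from `periodicTree`, or not at all
  let R : OnePoint (IsLocalRing.ResidueField A) → Prop := fun b => b = red A α ∨ b ∈ periodicPts G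
  let J : OnePoint L → ℕ := fun c =>
    if h : ∃ m, R (G^[m] (red A c)) then Nat.find h else 0
  refine ⟨⋃ m ∈ Finset.range (M.finite_crit.toFinset.sup J + 1), T m,
    Set.Finite.biUnion (Finset.finite_toSet _) fun m _ => hT m, fun σ hσ hσT n => ?_⟩
  have hσT' : ∀ m, m ≤ M.finite_crit.toFinset.sup J → ∀ t ∈ T m, σ t = t := fun m hm t ht => by
    refine hσT t ?_
    simp only [Set.mem_iUnion]
    exact ⟨m, Finset.mem_range.2 (Nat.lt_succ_of_le hm), ht⟩
  induction n with
  | zero =>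
    rintro x rfl
    exact hfix 0 σ hσ (hσT' 0 (Nat.zero_le _)) _ ⟨⟨0, rfl⟩, Or.inl rfl⟩
  | succ n ih =>
    intro x hx
    by_cases hw : M.wval x < 1
    · obtain ⟨c, hc, hcx⟩ := M.exists_crit_of_wval_lt_one hw
      have hR : R (G^[n + 1] (red A c)) := by
        left
        rw [hcx, ← M.red_iterate, hx]
      have hex : ∃ m, R (G^[m] (red A c)) := ⟨_, hR⟩
      have hJ : J c = Nat.find hex := dif_pos hex
      have hle : J c ≤ n + 1 := hJ ▸ Nat.find_min' hex hR
      have hspec : R (G^[J c] (red A c)) := hJ ▸ Nat.find_spec hex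
      refine hfix (J c) σ hσ (hσT' _ (Finset.le_sup (by simpa using hc))) x ⟨⟨n + 1 - J c, ?_⟩, ?_⟩
      · rw [← iterate_add_apply, Nat.sub_add_cancel hle, hx]
      · rw [M.red_iterate, ← hcx]
        exact hspec
    · exact M.fixed_of_noncritical hσ hw (ih (F x) hx)

/-! ### Backward orbits in a periodic critical disc -/

/-- In the cycle of a periodic critical disc, a power of `F` is a strict contraction of the disc of `α`
onto itself. So `α` has a backward orbit under this power whose successive distances increase
strictly, unless two successive points coincide, which makes `α` periodic. -/
theorem exists_backward_orbit {c : OnePoint L} (hc : c ∈ C) (hcα : c ∈ cycleDiscs A G (red A α))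
    (hα : α ∉ periodicPts F) : ∃ β : ℕ → OnePoint L, (∀ n, ∃ k, F^[k] (β n) = α) ∧
      (∀ n, chordal A (β (n + 1)) (β n) < 1) ∧
      ∀ n, chordal A (β (n + 1)) (β n) < chordal A (β (n + 2)) (β (n + 1)) := by
  obtain ⟨⟨N, hN, hper⟩, m, hm⟩ := hcα
  have hαN : G^[N] (red A α) = red A α := by
    rw [← hm, ← iterate_add_apply, add_comm, iterate_add_apply, hper.eq]
  -- the disc of `c` occurs in the orbit of `α` before time `N`
  obtain ⟨i, hi, hic⟩ : ∃ i < N, G^[i] (red A α) = red A c := by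
    refine ⟨(N - m % N) % N, Nat.mod_lt _ hN, ?_⟩
    rw [← hm, ← iterate_add_apply, ← hper.iterate_mod_apply]
    have : ((N - m % N) % N + m) % N = 0 := by
      rw [Nat.mod_add_mod, ← Nat.add_mod_mod, Nat.sub_add_cancel (Nat.mod_lt m hN).le, Nat.mod_self]
    rw [this]
    rfl
  have hstep : ∀ y : OnePoint L, red A y = red A α → ∃ z, F^[N] z = y ∧ red A z = red A α :=
    fun y hy => M.exists_iterate_eq_of_red N (by rw [M.red_iterate, hαN, hy])
  choose! ψ hψ hψr using hstep
  let β : ℕ → OnePoint L := fun n => ψ^[n] α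
  have hβr : ∀ n, red A (β n) = red A α := by
    intro n
    induction n with
    | zero => rfl
    | succ n ih =>
      change red A (ψ^[n + 1] α) = _
      rw [iterate_succ_apply']
      exact hψr _ ih
  have hβ : ∀ n, F^[N] (β (n + 1)) = β n := by
    intro n
    change F^[N] (ψ^[n + 1] α) = _
    rw [iterate_succ_apply']
    exact hψ _ (hβr n)
  have hβα : ∀ n, F^[N * n] (β n) = α := by
    intro n
    induction n with
    | zero => rfl
    | succ n ih => rw [Nat.mul_succ, iterate_add_apply, hβ, ih]
  have hlt : ∀ n, chordal A (β (n + 1)) (β n) < 1 := fun n => by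
    rw [chordal_lt_one_iff, hβr, hβr]
  have hne : ∀ n, β (n + 1) ≠ β n := by
    intro n h
    refine hα ⟨N, hN, ?_⟩
    have h1 := congrArg F^[N * n] h
    rw [hβα] at h1
    have h2 := congrArg F^[N] h1
    rw [← iterate_add_apply, add_comm, ← Nat.mul_succ, hβα] at h2
    exact h2.symm
  refine ⟨β, fun n => ⟨_, hβα n⟩, hlt, fun n => ?_⟩
  have hw : M.wval (F^[i] (β (n + 2))) < 1 :=
    M.wval_lt_one_of_crit hc (by rw [M.red_iterate, hβr, hic])
  have := M.chordal_iterate_lt (hlt (n + 1)) (hne (n + 1)) hi hw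
  rwa [hβ, hβ] at this

end IntegralModel

end PCFReduction

namespace PCFReduction

open ArborealPCF hiding map_mul map_one degree map_injective
open NumberField IsDedekindDomain Function
open scoped Pointwise

/-! ### The place of a number field below a place of its algebraic closure -/

section PlaceBelow

variable {Ω : Type*} [Field Ω] (A : ValuationSubring Ω)

/-- The place `A` lies above a finite prime: some positive integer is in its maximal ideal. -/
def HasResidueChar : Prop := ∃ n : ℕ, n ≠ 0 ∧ A.valuation (n : Ω) < 1

variable {A}

theorem redInt_eq_zero_iff {E : Type*} [Field E] [Algebra E Ω] (b : 𝓞 E) :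
    redInt E A b = 0 ↔ A.valuation (algebraMap E Ω b) < 1 := by
  change IsLocalRing.residue A _ = 0 ↔ _
  rw [IsLocalRing.residue_eq_zero_iff, A.valuation_lt_one_iff]
  rfl

theorem hasResidueChar_of_liesAbove {K : Type*} [Field K] [NumberField K] [Algebra K Ω]
    {𝔭 : HeightOneSpectrum (𝓞 K)} (hA : LiesAbove A 𝔭) : HasResidueChar A := by
  refine ⟨Ideal.absNorm 𝔭.asIdeal, ?_, ?_⟩
  · rw [Ne, Ideal.absNorm_eq_zero_iff]
    exact 𝔭.ne_bot
  · have h := Ideal.absNorm_mem 𝔭.asIdeal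
    have h' : (Ideal.absNorm 𝔭.asIdeal : 𝓞 K) ∈ RingHom.ker (redInt K A) := by
      rw [show RingHom.ker (redInt K A) = 𝔭.asIdeal from hA]
      exact h
    rw [RingHom.mem_ker, redInt_eq_zero_iff] at h'
    simpa using h'

variable (E : Type*) [Field E] [NumberField E] [Algebra E Ω]

/-- The prime of the number field `E` below the place `A`. -/
def primeBelow (hA : HasResidueChar A) : HeightOneSpectrum (𝓞 E) where
  asIdeal := RingHom.ker (redInt E A)
  isPrime := RingHom.ker_isPrime _
  ne_bot := by
    obtain ⟨n, hn, hlt⟩ := hA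
    intro h
    have : (n : 𝓞 E) ∈ RingHom.ker (redInt E A) := by
      rw [RingHom.mem_ker, redInt_eq_zero_iff]
      simpa using hlt
    rw [h, Ideal.mem_bot] at this
    exact hn (Nat.cast_eq_zero.1 this)

variable {E}

theorem mem_primeBelow (hA : HasResidueChar A) {b : 𝓞 E} :
    b ∈ (primeBelow E hA).asIdeal ↔ A.valuation (algebraMap E Ω b) < 1 :=
  redInt_eq_zero_iff b

theorem valuation_algebraMap_eq_one (hA : HasResidueChar A) {b : 𝓞 E}
    (hb : b ∉ (primeBelow E hA).asIdeal) : A.valuation (algebraMap E Ω b) = 1 :=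
  le_antisymm ((A.valuation_le_one_iff _).2 (algebraMap_integer_mem A b))
    (not_lt.1 fun h => hb ((mem_primeBelow hA).2 h))

/-- The restriction of the place `A` to a number field is the adic valuation of the prime below. -/
theorem valuation_primeBelow_isEquiv (hA : HasResidueChar A) :
    ((primeBelow E hA).valuation E).IsEquiv (A.valuation.comap (algebraMap E Ω)) := by
  set P := primeBelow E hA
  have key : ∀ z : E, P.valuation E z ≤ 1 → A.valuation (algebraMap E Ω z) ≤ 1 ∧
      (P.valuation E z < 1 → A.valuation (algebraMap E Ω z) < 1) := by
    intro z hz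
    obtain ⟨a, s, h⟩ := P.exists_primeCompl_mul_eq_of_integer z hz
    have hs : A.valuation (algebraMap E Ω (algebraMap (𝓞 E) E s)) = 1 :=
      valuation_algebraMap_eq_one hA s.2
    have h1 : A.valuation (algebraMap E Ω z) = A.valuation (algebraMap E Ω (algebraMap (𝓞 E) E a)) := by
      rw [← h, map_mul, map_mul, hs, mul_one]
    rw [h1]
    refine ⟨(A.valuation_le_one_iff _).2 (algebraMap_integer_mem A a), fun hlt => ?_⟩
    refine (mem_primeBelow hA).1 ((P.valuation_lt_one_iff_mem (K := E) a).1 ?_)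
    change P.valuation E (algebraMap (𝓞 E) E a) < 1
    rw [← h, map_mul, mul_comm]
    exact mul_lt_of_le_one_of_lt (P.valuation_le_one _) hlt
  refine Valuation.isEquiv_of_val_le_one fun {z} => ⟨fun h => (key z h).1, fun h => ?_⟩
  by_contra hcon
  rw [not_le] at hcon
  have hlt : P.valuation E z⁻¹ < 1 := by
    rw [map_inv₀]; exact inv_lt_one_of_one_lt₀ hcon
  have h2 := (key z⁻¹ hlt.le).2 hlt
  rw [map_inv₀, map_inv₀] at h2
  have hz : A.valuation (algebraMap E Ω z) ≠ 0 := by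
    rw [Valuation.ne_zero_iff, Ne, FaithfulSMul.algebraMap_eq_zero_iff]
    rintro rfl
    simp at hcon
  exact absurd h2 (not_lt.2 ((one_le_inv₀ (zero_lt_iff.2 hz)).2 h))

theorem valuation_le_iff_primeBelow (hA : HasResidueChar A) (y z : E) :
    A.valuation (algebraMap E Ω y) ≤ A.valuation (algebraMap E Ω z) ↔
      (primeBelow E hA).valuation E y ≤ (primeBelow E hA).valuation E z :=
  ((valuation_primeBelow_isEquiv hA) y z).symm

theorem valuation_lt_iff_primeBelow (hA : HasResidueChar A) (y z : E) :
    A.valuation (algebraMap E Ω y) < A.valuation (algebraMap E Ω z) ↔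
      (primeBelow E hA).valuation E y < (primeBelow E hA).valuation E z := by
  rw [← not_le, ← not_le, valuation_le_iff_primeBelow]

theorem valuation_lt_one_iff_primeBelow (hA : HasResidueChar A) (y : E) :
    A.valuation (algebraMap E Ω y) < 1 ↔ (primeBelow E hA).valuation E y < 1 := by
  simpa using valuation_lt_iff_primeBelow hA y 1

theorem valuation_le_one_iff_primeBelow (hA : HasResidueChar A) (y : E) :
    A.valuation (algebraMap E Ω y) ≤ 1 ↔ (primeBelow E hA).valuation E y ≤ 1 := by
  simpa using valuation_le_iff_primeBelow hA y 1

end PlaceBelow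

section Archimedean

variable {K : Type*} [Field K] [NumberField K] {Ω : Type*} [Field Ω] [Algebra K Ω]
  [Algebra.IsAlgebraic K Ω] {A : ValuationSubring Ω}

theorem numberField_of_finite {E : Type*} [Field E] [Algebra K E] [FiniteDimensional K E] :
    NumberField E :=
  NumberField.of_module_finite K E

/-- The value group of a place above a finite prime is archimedean. -/
theorem exists_pow_valuation_lt (K : Type*) [Field K] [NumberField K] [Algebra K Ω]
    [Algebra.IsAlgebraic K Ω] (hA : HasResidueChar A) {x : Ω} (hx : A.valuation x < 1)
    {y : Ω} (hy : y ≠ 0) : ∃ n : ℕ, A.valuation x ^ n < A.valuation y := by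
  let E := IntermediateField.adjoin K {x, y}
  have : FiniteDimensional K E := IntermediateField.finiteDimensional_adjoin
    fun z _ => Algebra.IsIntegral.isIntegral z
  have : NumberField E := numberField_of_finite (K := K)
  let x' : E := ⟨x, IntermediateField.subset_adjoin _ _ (by simp)⟩
  let y' : E := ⟨y, IntermediateField.subset_adjoin _ _ (by simp)⟩
  have hx' : (primeBelow E hA).valuation E x' < 1 := (valuation_lt_one_iff_primeBelow hA x').1 hx
  have hy' : (primeBelow E hA).valuation E y' ≠ 0 := by
    rw [Valuation.ne_zero_iff]
    exact fun h => hy (congrArg Subtype.val h)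
  obtain ⟨n, hn⟩ := exists_pow_lt₀ hx' (Units.mk0 _ hy')
  refine ⟨n, ?_⟩
  rw [Units.val_mk0, ← map_pow] at hn
  have := (valuation_lt_iff_primeBelow hA (x' ^ n) y').2 hn
  rwa [map_pow, map_pow] at this

universe u in
/-- The residue rings of `A ∩ E`, for a number field `E`, are finite. -/
theorem exists_finite_coloring (hA : HasResidueChar A) (E : Type u) [Field E] [NumberField E]
    [Algebra E Ω] [Algebra.IsAlgebraic E Ω] {ε : A.ValueGroup} (hε : ε ≠ 0) :
    ∃ (κ : Type u) (_ : Finite κ) (col : E → κ), ∀ z z' : E, algebraMap E Ω z ∈ A →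
      algebraMap E Ω z' ∈ A → col z = col z' → A.valuation (algebraMap E Ω (z - z')) < ε := by
  classical
  obtain ⟨y, rfl⟩ := A.valuation_surjective ε
  have hy : y ≠ 0 := (Valuation.ne_zero_iff _).1 hε
  obtain ⟨n, hn0, hn⟩ := id hA
  obtain ⟨k, hk⟩ := exists_pow_valuation_lt E hA hn hy
  let P := primeBelow E hA
  let t : 𝓞 E := (n : 𝓞 E) ^ k
  have ht : t ≠ 0 := pow_ne_zero _ (Nat.cast_ne_zero.2 hn0)
  have htv : A.valuation (algebraMap E Ω (algebraMap (𝓞 E) E t)) < A.valuation y := by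
    simpa [t] using hk
  have hPt : P.valuation E (algebraMap (𝓞 E) E t) ≠ 0 := by
    rw [Valuation.ne_zero_iff]
    simpa using ht
  have happ : ∀ z : E, algebraMap E Ω z ∈ A → ∃ a : 𝓞 E,
      A.valuation (algebraMap E Ω (algebraMap (𝓞 E) E a - z)) < A.valuation y := by
    intro z hz
    obtain ⟨a, ha⟩ := P.exists_valuation_sub_lt_of_integer
      ((valuation_le_one_iff_primeBelow hA z).1 ((A.valuation_le_one_iff _).2 hz)) (Units.mk0 _ hPt)
    exact ⟨a, ((valuation_lt_iff_primeBelow hA _ _).2 ha).trans htv⟩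
  choose! r hr using happ
  refine ⟨𝓞 E ⧸ Ideal.span {t}, Ideal.finiteQuotientOfFreeOfNeBot _ (by simpa using ht),
    fun z => Ideal.Quotient.mk _ (r z), fun z z' hz hz' h => ?_⟩
  rw [Ideal.Quotient.eq, Ideal.mem_span_singleton'] at h
  obtain ⟨b, hb⟩ := h
  have h1 : z - z' = (algebraMap (𝓞 E) E (r z') - z') - (algebraMap (𝓞 E) E (r z) - z) +
      algebraMap (𝓞 E) E b * algebraMap (𝓞 E) E t := by
    rw [← map_mul, hb, map_sub]
    ring
  rw [h1, map_add, map_sub]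
  refine (A.valuation.map_add _ _).trans_lt (max_lt
    ((A.valuation.map_sub _ _).trans_lt (max_lt (hr z' hz') (hr z hz))) ?_)
  rw [map_mul, map_mul]
  exact (mul_le_of_le_one_left' ((A.valuation_le_one_iff _).2 (algebraMap_integer_mem A b))).trans_lt htv

end Archimedean

/-! ### Inertia -/

section Inertia

variable {K Ω : Type*} [Field K] [Field Ω] [Algebra K Ω] {A : ValuationSubring Ω}

theorem mem_inertia_iff {σ : Ω ≃ₐ[K] Ω} : σ ∈ inertia K A ↔
    (∀ x, σ x ∈ A ↔ x ∈ A) ∧ ∀ x ∈ A, A.valuation (σ x - x) < 1 := by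
  have hdec : σ ∈ A.decompositionSubgroup K ↔ ∀ x, σ x ∈ A ↔ x ∈ A := by
    rw [MulAction.mem_stabilizer_iff]
    constructor
    · intro h x
      have : σ x ∈ σ • A ↔ x ∈ A := ValuationSubring.smul_mem_pointwise_smul_iff
      rwa [h] at this
    · intro h
      refine ValuationSubring.ext _ _ fun x => ?_
      obtain ⟨y, rfl⟩ := σ.surjective x
      have : σ y ∈ σ • A ↔ y ∈ A := ValuationSubring.smul_mem_pointwise_smul_iff
      rw [this, h]
  have hker : ∀ τ : A.decompositionSubgroup K, τ ∈ A.inertiaSubgroup K ↔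
      ∀ x ∈ A, A.valuation ((τ : Ω ≃ₐ[K] Ω) x - x) < 1 := by
    intro τ
    have h1 : ∀ x : A, τ • IsLocalRing.residue A x = IsLocalRing.residue A x ↔
        A.valuation ((τ : Ω ≃ₐ[K] Ω) x - x) < 1 := by
      intro x
      change IsLocalRing.residue A (τ • x) = _ ↔ _
      rw [← sub_eq_zero, ← map_sub, IsLocalRing.residue_eq_zero_iff, A.valuation_lt_one_iff]
      rfl
    rw [ValuationSubring.inertiaSubgroup, MonoidHom.mem_ker]
    constructor
    · intro h x hx
      rw [← h1 ⟨x, hx⟩]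
      exact DFunLike.congr_fun h _
    · intro h
      ext y
      obtain ⟨x, rfl⟩ := IsLocalRing.residue_surjective y
      exact (h1 x).2 (h x x.2)
  constructor
  · rintro ⟨τ, hτ, rfl⟩
    exact ⟨hdec.1 τ.2, (hker τ).1 hτ⟩
  · rintro ⟨h1, h2⟩
    exact ⟨⟨σ, hdec.2 h1⟩, (hker ⟨σ, hdec.2 h1⟩).2 h2, rfl⟩

/-- An automorphism of an algebraic extension which preserves a valuation ring preserves the
valuation. -/
theorem valuation_map_eq [Algebra.IsAlgebraic K Ω] {σ : Ω ≃ₐ[K] Ω} (h : ∀ x, σ x ∈ A ↔ x ∈ A)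
    (x : Ω) : A.valuation (σ x) = A.valuation x := by
  have hle : ∀ x y, A.valuation (σ x) ≤ A.valuation (σ y) ↔ A.valuation x ≤ A.valuation y := by
    intro x y
    rw [A.valuation_le_iff, A.valuation_le_iff]
    constructor
    · rintro ⟨a, ha⟩
      refine ⟨⟨σ.symm a, by rw [← h]; simp⟩, σ.injective ?_⟩
      simp [ha]
    · rintro ⟨a, ha⟩
      exact ⟨⟨σ a, (h a).2 a.2⟩, by simp [← ha]⟩
  have hlt : ∀ x y, A.valuation (σ x) < A.valuation (σ y) ↔ A.valuation x < A.valuation y := by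
    intro x y
    rw [← not_le, ← not_le, hle]
  -- the orbit of `x` is finite, so the values along it cannot be strictly monotone
  have hfin : Finite (Set.range fun n : ℕ => σ^[n] x) := by
    have hroots := (minpoly K x).rootSet_finite Ω
    refine hroots.subset ?_
    rintro _ ⟨n, rfl⟩
    have hit : ∀ n : ℕ, Polynomial.aeval (σ^[n] x) (minpoly K x) = 0 := by
      intro n
      induction n with
      | zero => exact minpoly.aeval K x
      | succ n ih =>
        rw [Function.iterate_succ_apply']
        change Polynomial.aeval (σ.toAlgHom _) _ = 0
        rw [Polynomial.aeval_algHom_apply, ih, map_zero]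
    exact Polynomial.mem_rootSet.2
      ⟨minpoly.ne_zero (Algebra.IsIntegral.isIntegral x), hit n⟩
  obtain ⟨a, b, hab, heq⟩ := Finite.exists_ne_map_eq_of_infinite
    (Set.rangeFactorization fun n : ℕ => σ^[n] x)
  replace heq : σ^[a] x = σ^[b] x := congrArg Subtype.val heq
  rcases lt_trichotomy (A.valuation (σ x)) (A.valuation x) with h1 | h1 | h1
  · have hanti : StrictAnti fun n : ℕ => A.valuation (σ^[n] x) := by
      refine strictAnti_nat_of_succ_lt fun n => ?_
      induction n with
      | zero => exact h1
      | succ n ih =>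
        rw [Function.iterate_succ_apply', Function.iterate_succ_apply' σ n, hlt,
          ← Function.iterate_succ_apply' σ n x]
        exact ih
    exact absurd (hanti.injective (congrArg A.valuation heq)) hab
  · exact h1
  · have hmono : StrictMono fun n : ℕ => A.valuation (σ^[n] x) := by
      refine strictMono_nat_of_lt_succ fun n => ?_
      induction n with
      | zero => exact h1
      | succ n ih =>
        rw [Function.iterate_succ_apply' σ (n + 1), Function.iterate_succ_apply' σ n, hlt,
          ← Function.iterate_succ_apply' σ n x]
        exact ih
    exact absurd (hmono.injective (congrArg A.valuation heq)) hab

end Inertia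

/-! ### Discreteness of the values on the inertia field -/

section InertiaField

variable {Ω : Type*} [Field Ω] {A : ValuationSubring Ω}

/-- The centre of `A` on the ring of all algebraic integers. -/
def centre (A : ValuationSubring Ω) : Ideal (𝓞 Ω) := RingHom.ker (redInt Ω A)

instance : (centre A).IsPrime := RingHom.ker_isPrime _

theorem mem_centre {b : 𝓞 Ω} : b ∈ centre A ↔ A.valuation (b : Ω) < 1 := redInt_eq_zero_iff b

theorem valuation_eq_one_of_notMem_centre {b : 𝓞 Ω} (hb : b ∉ centre A) : A.valuation (b : Ω) = 1 :=
  le_antisymm ((A.valuation_le_one_iff _).2 (algebraMap_integer_mem A b))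
    (not_lt.1 fun h => hb (mem_centre.2 h))

/-- The valuation ring `A` is the localization of the ring of algebraic integers at its centre. -/
theorem exists_integer_fraction (E : Type*) [Field E] [NumberField E] [Algebra E Ω]
    [IsAlgClosure E Ω] (hA : HasResidueChar A) {x : Ω} (hx : x ∈ A) :
    ∃ a t : 𝓞 Ω, t ∉ centre A ∧ x * t = a := by
  have : Algebra.IsAlgebraic E Ω := IsAlgClosure.isAlgebraic
  let L := IntermediateField.adjoin E {x}
  have : FiniteDimensional E L := IntermediateField.finiteDimensional_adjoin
    fun z _ => Algebra.IsIntegral.isIntegral z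
  have : NumberField L := numberField_of_finite (K := E)
  let x' : L := ⟨x, IntermediateField.subset_adjoin _ _ (by simp)⟩
  obtain ⟨a, s, h⟩ := (primeBelow L hA).exists_primeCompl_mul_eq_of_integer x'
    ((valuation_le_one_iff_primeBelow hA x').1 ((A.valuation_le_one_iff _).2 hx))
  refine ⟨algebraMap (𝓞 L) (𝓞 Ω) a, algebraMap (𝓞 L) (𝓞 Ω) s, fun hs => s.2 ?_, ?_⟩
  · exact (mem_primeBelow hA).2 (mem_centre.1 hs)
  · exact congrArg (algebraMap L Ω) h

theorem liesOver_centre {L : Type*} [Field L] [NumberField L] [Algebra L Ω] (hA : HasResidueChar A) :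
    (centre A).LiesOver (primeBelow L hA).asIdeal := ⟨by
  ext b
  rw [Ideal.under_def, Ideal.mem_comap, mem_centre]
  exact mem_primeBelow hA⟩

variable {E : Type*} [Field E] [Algebra E Ω] [IsAlgClosure E Ω]

/-- Automorphisms that act trivially modulo the centre of `A` are in the inertia group. -/
theorem inertia_of_centre [NumberField E] (hA : HasResidueChar A) {σ : Ω ≃ₐ[E] Ω}
    (h : ∀ b : 𝓞 Ω, A.valuation (σ b - b) < 1) :
    (∀ x, σ x ∈ A ↔ x ∈ A) ∧ ∀ x ∈ A, A.valuation (σ x - x) < 1 := by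
  have hint : ∀ (τ : Ω ≃ₐ[E] Ω) (b : 𝓞 Ω), ∃ b' : 𝓞 Ω, (b' : Ω) = τ b := fun τ b => ⟨τ • b, rfl⟩
  have hle : ∀ b : 𝓞 Ω, A.valuation (b : Ω) ≤ 1 := fun b =>
    (A.valuation_le_one_iff _).2 (algebraMap_integer_mem A b)
  have main : ∀ τ : Ω ≃ₐ[E] Ω, (∀ b : 𝓞 Ω, A.valuation (τ b - b) < 1) →
      ∀ x ∈ A, A.valuation (τ x - x) < 1 := by
    intro τ hτ x hx
    obtain ⟨a, t, ht, hxt⟩ := exists_integer_fraction E hA hx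
    have ht1 := valuation_eq_one_of_notMem_centre ht
    have ht2 : A.valuation (τ t) = 1 := by
      rw [← sub_add_cancel (τ (t : Ω)) t, Valuation.map_add_eq_of_lt_right _ (by rw [ht1]; exact hτ t),
        ht1]
    have h0 : (t : Ω) * τ t ≠ 0 := by
      refine mul_ne_zero ?_ ?_ <;> rw [← Valuation.ne_zero_iff A.valuation]
      · rw [ht1]; exact one_ne_zero
      · rw [ht2]; exact one_ne_zero
    have h1 : A.valuation ((τ x - x) * (t * τ t)) = A.valuation (τ x - x) := by
      rw [map_mul, map_mul, ht1, ht2, mul_one, mul_one]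
    have h2 : (τ x - x) * (t * τ t) = (τ a - a) * t - a * (τ t - t) := by
      rw [← hxt, map_mul]
      ring
    rw [← h1, h2]
    refine (A.valuation.map_sub _ _).trans_lt (max_lt ?_ ?_) <;> rw [map_mul]
    · rw [ht1, mul_one]
      exact hτ a
    · exact mul_lt_of_le_one_of_lt (hle a) (hτ t)
  have hsymm : ∀ b : 𝓞 Ω, A.valuation (σ.symm b - b) < 1 := by
    intro b
    obtain ⟨b', hb'⟩ := hint σ.symm b
    have := h b'
    rw [hb', σ.apply_symm_apply, Valuation.map_sub_swap] at this
    exact this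
  have hmem : ∀ τ : Ω ≃ₐ[E] Ω, (∀ b : 𝓞 Ω, A.valuation (τ b - b) < 1) → ∀ x ∈ A, τ x ∈ A := by
    intro τ hτ x hx
    rw [← sub_add_cancel (τ x) x]
    exact A.add_mem _ _ ((A.valuation_le_one_iff _).1 (main τ hτ x hx).le) hx
  refine ⟨fun x => ⟨fun hx => ?_, hmem σ h x⟩, main σ h⟩
  have := hmem σ.symm hsymm _ hx
  rwa [σ.symm_apply_apply] at this

/-- Every element of the inertia group of a finite Galois extension lifts to the inertia group of
`A`. -/
theorem exists_lift_inertia [NumberField E] (hA : HasResidueChar A) (L : IntermediateField E Ω)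
    [FiniteDimensional E L] [IsGalois E L] [NumberField L] {s : L ≃ₐ[E] L}
    (hs : s ∈ (primeBelow L hA).asIdeal.inertia (L ≃ₐ[E] L)) :
    ∃ σ : Ω ≃ₐ[E] Ω, ((∀ x, σ x ∈ A ↔ x ∈ A) ∧ ∀ x ∈ A, A.valuation (σ x - x) < 1) ∧
      ∀ y : L, σ y = s y := by
  have hcl : IsAlgClosed Ω := IsAlgClosure.isAlgClosed E
  have halg : Algebra.IsAlgebraic E Ω := IsAlgClosure.isAlgebraic
  have : Algebra.IsAlgebraic L Ω := Algebra.IsAlgebraic.tower_top (K := E) L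
  have : IsAlgClosure L Ω := ⟨hcl, inferInstance⟩
  have : IsGalois L Ω := IsAlgClosure.isGalois L Ω
  have : Normal E Ω := IsAlgClosure.normal E Ω
  obtain ⟨σ₀, hσ₀⟩ : ∃ σ₀ : Ω ≃ₐ[E] Ω, ∀ y : L, σ₀ y = s y :=
    ⟨s.liftNormal Ω, s.liftNormal_commutes Ω⟩
  let G := Ω ≃ₐ[L] Ω
  let P := (primeBelow L hA).asIdeal
  let Q := centre A
  have hPQ : Q.LiesOver P := liesOver_centre hA
  let : TopologicalSpace (𝓞 Ω) := ⊥
  have : DiscreteTopology (𝓞 Ω) := ⟨rfl⟩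
  have : ContinuousSMul G (𝓞 Ω) := by
    rw [continuousSMul_iff_stabilizer_isOpen]
    intro b
    have h1 := stabilizer_isOpen_of_isIntegral (K := L) (L := Ω) (b : Ω)
    convert h1 using 1
    ext g
    simp only [SetLike.mem_coe, MulAction.mem_stabilizer_iff]
    exact RingOfIntegers.ext_iff
  have : SMulCommClass G (𝓞 L) (𝓞 Ω) := ⟨fun g a b => by
    apply RingOfIntegers.ext
    rw [Algebra.smul_def, Algebra.smul_def, smul_mul']
    change g (algebraMap L Ω a) * g b = algebraMap L Ω a * g b
    rw [g.commutes]⟩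
  have : Algebra.IsInvariant (𝓞 L) (𝓞 Ω) G := ⟨fun b hb => by
    have : (b : Ω) ∈ Set.range (algebraMap L Ω) :=
      (InfiniteGalois.mem_range_algebraMap_iff_fixed (k := L) (b : Ω)).2
        fun g => congrArg (algebraMap (𝓞 Ω) Ω) (hb g)
    obtain ⟨a, ha⟩ := this
    have hint : IsIntegral ℤ a := by
      rw [← isIntegral_algebraMap_iff (algebraMap L Ω).injective, ha]
      exact b.2
    exact ⟨⟨a, hint⟩, RingOfIntegers.ext ha⟩⟩
  -- an automorphism preserving the centre, extending `s`
  obtain ⟨g, hg⟩ := Algebra.IsInvariant.exists_smul_of_under_eq_of_profinite (A := 𝓞 L) (G := G)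
    (σ₀ • Q) Q (by
      rw [← hPQ.over]
      ext b
      rw [Ideal.under_def, Ideal.mem_comap, Ideal.mem_pointwise_smul_iff_inv_smul_mem]
      have h1 : s⁻¹ • b ∈ P ↔ b ∈ P := by
        rw [← Ideal.mem_pointwise_smul_iff_inv_smul_mem, Ideal.inertia_le_stabilizer P hs]
      have h2 : (σ₀⁻¹ • algebraMap (𝓞 L) (𝓞 Ω) b : 𝓞 Ω) = algebraMap (𝓞 L) (𝓞 Ω) (s⁻¹ • b) := by
        apply RingOfIntegers.ext
        apply σ₀.injective
        change σ₀ (σ₀.symm (algebraMap L Ω b)) = σ₀ ((s.symm b : L) : Ω)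
        rw [hσ₀, σ₀.apply_symm_apply, s.apply_symm_apply]
        rfl
      rw [h2, ← h1, hPQ.over]
      rfl)
  let σ₁ : Ω ≃ₐ[E] Ω := (g.restrictScalars E) * σ₀
  have hσ₁ : ∀ y : L, σ₁ y = s y := fun y => by
    change g (σ₀ y) = s y
    rw [hσ₀]
    exact g.commutes (s y)
  have hσ₁Q : ∀ b : 𝓞 Ω, σ₁ • b ∈ Q ↔ b ∈ Q := fun b => by
    have : σ₁ • b = g • σ₀ • b := rfl
    rw [this]
    conv_lhs => rw [hg]
    rw [Ideal.smul_mem_pointwise_smul_iff, Ideal.smul_mem_pointwise_smul_iff]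
  let e : 𝓞 Ω ≃+* 𝓞 Ω := MulSemiringAction.toRingEquiv (Ω ≃ₐ[E] Ω) (𝓞 Ω) σ₁
  have he : Q = Q.map (e : 𝓞 Ω →+* 𝓞 Ω) := by
    ext b
    have h1 := Ideal.mem_map_of_equiv e (I := Q) b
    change _ ↔ b ∈ Q.map e
    rw [h1]
    constructor
    · intro hb
      refine ⟨e.symm b, (hσ₁Q _).1 ?_, e.apply_symm_apply b⟩
      change e (e.symm b) ∈ Q
      rwa [e.apply_symm_apply]
    · rintro ⟨x, hx, rfl⟩
      exact (hσ₁Q x).2 hx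
  -- its action modulo the centre, which is linear over the residue field of `L` as `s` is inertial
  let ebar : (𝓞 Ω ⧸ Q) ≃ₐ[𝓞 L ⧸ P] (𝓞 Ω ⧸ Q) := AlgEquiv.ofRingEquiv (f := Ideal.quotientEquiv Q Q e he) (by
    intro b
    obtain ⟨b, rfl⟩ := Ideal.Quotient.mk_surjective b
    change Ideal.Quotient.mk Q (σ₁ • algebraMap (𝓞 L) (𝓞 Ω) b) =
      Ideal.Quotient.mk Q (algebraMap (𝓞 L) (𝓞 Ω) b)
    have h2 : (σ₁ • algebraMap (𝓞 L) (𝓞 Ω) b : 𝓞 Ω) = algebraMap (𝓞 L) (𝓞 Ω) (s • b) :=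
      RingOfIntegers.ext (hσ₁ b)
    rw [h2, Ideal.Quotient.eq, ← map_sub]
    have h3 : s • b - b ∈ P := hs b
    rw [hPQ.over] at h3
    exact h3)
  -- correct it by an automorphism over `L` with the same effect modulo the centre
  obtain ⟨h, hh⟩ := Ideal.Quotient.stabilizerHom_surjective_of_profinite (G := G) P Q ebar
  have hhQ : ∀ b : 𝓞 Ω, (h : G) • b - σ₁ • b ∈ Q := fun b => by
    rw [← Ideal.Quotient.eq]
    exact DFunLike.congr_fun hh (Ideal.Quotient.mk Q b)
  refine ⟨((h : G)⁻¹.restrictScalars E) * σ₁, inertia_of_centre hA fun b => ?_, fun y => ?_⟩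
  · have h4 : (h : G)⁻¹ • ((h : G) • b - σ₁ • b) ∈ Q := by
      have h5 : (h : G)⁻¹ • Q = Q := (h⁻¹).2
      exact h5.le (Ideal.smul_mem_pointwise_smul_iff.2 (hhQ b))
    rw [smul_sub, inv_smul_smul] at h4
    have h6 := mem_centre.1 h4
    rw [Valuation.map_sub_swap]
    exact h6
  · change (h : G)⁻¹ (σ₁ y) = s y
    rw [hσ₁]
    exact ((h : G)⁻¹).commutes (s y)

/-- In a Galois extension of number fields, the ramification index is the order of the inertia group. -/
theorem valuation_algebraMap_eq_pow_card_inertia {F L : Type*} [Field F] [NumberField F] [Field L]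
    [NumberField L] [Algebra F L] (G : Type*) [Group G] [Finite G] [MulSemiringAction G L]
    [IsGaloisGroup G F L] (v : HeightOneSpectrum (𝓞 F)) (w : HeightOneSpectrum (𝓞 L))
    [w.asIdeal.LiesOver v.asIdeal] (x : F) :
    w.valuation L (algebraMap F L x) = v.valuation F x ^ Nat.card (w.asIdeal.inertia G) := by
  have : v.asIdeal.IsMaximal := v.isMaximal
  have : Finite (𝓞 F ⧸ v.asIdeal) := Ring.HasFiniteQuotients.finiteQuotient v.ne_bot
  rw [← HeightOneSpectrum.valuation_liesOver L v w, Ideal.card_inertia_eq_ramificationIdxIn v.asIdeal,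
    Ideal.ramificationIdxIn_eq_ramificationIdx v.asIdeal w.asIdeal G,
    Ideal.ramificationIdx'_eq_ramificationIdx _ _ v.ne_bot]

/-- The inertia field of a finite Galois extension is unramified over the base: both it and the base have
the order of the inertia group as their ramification index in the extension. -/
theorem valuation_inertiaField_le {E L : Type*} [Field E] [NumberField E] [Field L]
    [NumberField L] [Algebra E L] [IsGalois E L] (v : HeightOneSpectrum (𝓞 E))
    (w : HeightOneSpectrum (𝓞 L)) [w.asIdeal.LiesOver v.asIdeal] {ϖ : E}
    (hϖ : v.valuation E ϖ = WithZero.exp (-1 : ℤ)) {x : L}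
    (hx : ∀ s ∈ w.asIdeal.inertia (L ≃ₐ[E] L), s x = x) (hx1 : w.valuation L x < 1) :
    w.valuation L x ≤ w.valuation L (algebraMap E L ϖ) := by
  let I := w.asIdeal.inertia (L ≃ₐ[E] L)
  let F : IntermediateField E L := FixedPoints.intermediateField I
  have : NumberField F := numberField_of_finite (K := E)
  let u : HeightOneSpectrum (𝓞 F) := w.under (𝓞 F)
  have : w.asIdeal.LiesOver u.asIdeal := ⟨rfl⟩
  let x' : F := ⟨x, fun s => hx s s.2⟩
  have h1 := valuation_algebraMap_eq_pow_card_inertia (L ≃ₐ[E] L) v w ϖ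
  have h2 := valuation_algebraMap_eq_pow_card_inertia I u w x'
  have h3 : w.asIdeal.inertia I = ⊤ := by
    rw [eq_top_iff]
    intro s _ b
    exact s.2 b
  have h4 : Nat.card (w.asIdeal.inertia I) = Nat.card I := by
    rw [h3]; exact Subgroup.card_top
  have hx2 : algebraMap F L x' = x := rfl
  replace h2 : w.valuation L x = u.valuation F x' ^ Nat.card I :=
    hx2 ▸ h2.trans (congrArg (u.valuation F x' ^ ·) h4)
  rw [h1, hϖ, h2]
  refine pow_le_pow_left' ?_ _
  have h5 : u.valuation F x' < 1 := by
    rw [h2] at hx1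
    by_contra h
    exact absurd hx1 (not_lt.2 (one_le_pow₀ (not_lt.1 h)))
  rw [← WithZero.lt_mul_exp_iff_le (by simp)]
  simpa using h5

/-- The values below one of `A` on its inertia field over `E` are at most that of a uniformizer of
`E`. -/
theorem exists_valuation_le_of_inertia_fixed (E : Type*) [Field E] [NumberField E] [Algebra E Ω]
    [IsAlgClosure E Ω] (hA : HasResidueChar A) : ∃ ϖ : Ω, ϖ ≠ 0 ∧ A.valuation ϖ < 1 ∧
      ∀ x : Ω, (∀ σ ∈ inertia E A, σ x = x) → A.valuation x < 1 → A.valuation x ≤ A.valuation ϖ := by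
  have halg : Algebra.IsAlgebraic E Ω := IsAlgClosure.isAlgebraic
  have : Normal E Ω := IsAlgClosure.normal E Ω
  obtain ⟨ϖ, hϖ⟩ := (primeBelow E hA).valuation_exists_uniformizer E
  refine ⟨algebraMap E Ω ϖ, ?_, ?_, fun x hx hx1 => ?_⟩
  · rw [Ne, FaithfulSMul.algebraMap_eq_zero_iff]
    rintro rfl
    rw [map_zero] at hϖ
    exact WithZero.exp_ne_zero hϖ.symm
  · rw [valuation_lt_one_iff_primeBelow hA, hϖ]
    decide
  have : IsGalois E Ω := ⟨⟩
  let L := (FiniteGaloisIntermediateField.adjoin E {x}).toIntermediateField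
  have : NumberField L := numberField_of_finite (K := E)
  let x' : L := ⟨x, FiniteGaloisIntermediateField.subset_adjoin _ _ (by simp)⟩
  have hlies : (primeBelow L hA).asIdeal.LiesOver (primeBelow E hA).asIdeal := ⟨by
    ext b
    rw [Ideal.under_def, Ideal.mem_comap, mem_primeBelow, mem_primeBelow]
    rfl⟩
  have key := valuation_inertiaField_le (primeBelow E hA) (primeBelow L hA) hϖ (x := x')
    (fun s hs => by
      obtain ⟨σ, hσ, hσs⟩ := exists_lift_inertia hA L hs
      apply Subtype.ext
      rw [← hσs]
      exact hx σ (mem_inertia_iff.2 hσ))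
    ((valuation_lt_one_iff_primeBelow hA x').1 hx1)
  exact (valuation_le_iff_primeBelow hA _ _).2 key

end InertiaField

/-! ### The Galois action on the preimage tree -/

section GaloisAction

variable {K : Type*} [Field K] {Ω : Type*} [Field Ω] [Algebra K Ω] {A : ValuationSubring Ω}

/-- Automorphisms preserving `A` act on the standard unimodular coordinates. -/
theorem coord_map {σ : Ω ≃ₐ[K] Ω} (h : ∀ x, σ x ∈ A ↔ x ∈ A) (x : OnePoint Ω) :
    (coordX A (x.map σ) : Ω) = σ (coordX A x) ∧ (coordY A (x.map σ) : Ω) = σ (coordY A x) := by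
  induction x using OnePoint.rec with
  | infty => simp [coordX_infty, coordY_infty]
  | coe x =>
    rw [OnePoint.map_some]
    by_cases hx : x ∈ A
    · have hx' := (h x).2 hx
      simp [coordX_coe_mem hx, coordY_coe_mem hx, coordX_coe_mem hx', coordY_coe_mem hx']
    · have hx' := (h x).not.2 hx
      simp [coordX_coe_notMem hx, coordY_coe_notMem hx, coordX_coe_notMem hx',
        coordY_coe_notMem hx']

theorem isInertial_of_mem_inertia [Algebra.IsAlgebraic K Ω] (f : RatFunc K) {σ : Ω ≃ₐ[K] Ω}
    (hσ : σ ∈ inertia K A) : IsInertial A (toMap Ω f) (OnePoint.map σ) := by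
  obtain ⟨h1, h2⟩ := mem_inertia_iff.1 hσ
  refine ⟨fun x y => ?_, fun x => ?_, toMap_map f σ⟩
  · rw [chordal, chordal, (coord_map h1 x).1, (coord_map h1 x).2, (coord_map h1 y).1,
      (coord_map h1 y).2, ← map_mul, ← map_mul, ← map_sub, valuation_map_eq h1]
  · rw [← chordal_lt_one_iff, chordal, (coord_map h1 x).1, (coord_map h1 x).2]
    have h3 : σ (coordX A x) * (coordY A x : Ω) - coordX A x * σ (coordY A x) =
        (σ (coordX A x) - coordX A x) * coordY A x - coordX A x * (σ (coordY A x) - coordY A x) := by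
      ring
    rw [h3]
    refine (A.valuation.map_sub _ _).trans_lt (max_lt ?_ ?_) <;> rw [map_mul]
    · exact mul_lt_of_lt_of_le_one (h2 _ (coordX A x).2) ((A.valuation_le_one_iff _).2 (coordY A x).2)
    · exact mul_lt_of_le_one_of_lt ((A.valuation_le_one_iff _).2 (coordX A x).2) (h2 _ (coordY A x).2)

/-- An automorphism acts trivially on the tree exactly if it fixes every point of the backward orbit. -/
theorem arborealRep_eq_one_iff {f : RatFunc K} {α : OnePoint Ω} {σ : baseGalois K α} :
    arborealRep f α σ = 1 ↔ ∀ n x, (toMap Ω f)^[n] x = α → x.map σ.1 = x := by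
  constructor
  · intro h n x hx
    have := DFunLike.congr_fun h (⟨(n, x), hx⟩ : Tree f α)
    exact congrArg (fun v : Tree f α => v.1.2) this
  · intro h
    ext v
    apply Subtype.ext
    exact Prod.ext rfl (h v.1.1 v.1.2 v.2)

theorem exists_finite_extension [Algebra.IsAlgebraic K Ω] {T : Set (OnePoint Ω)} (hT : T.Finite) :
    ∃ E : IntermediateField K Ω, FiniteDimensional K E ∧
      ∀ σ ∈ E.fixingSubgroup, ∀ t ∈ T, t.map σ = t := by
  let S : Set Ω := (fun x : Ω => (x : OnePoint Ω)) ⁻¹' T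
  have : Finite S := hT.preimage (OnePoint.coe_injective.injOn)
  refine ⟨IntermediateField.adjoin K S, IntermediateField.finiteDimensional_adjoin
    fun z _ => Algebra.IsIntegral.isIntegral z, fun σ hσ t ht => ?_⟩
  induction t using OnePoint.rec with
  | infty => rfl
  | coe x =>
    rw [OnePoint.map_some]
    exact congrArg _ ((IntermediateField.mem_fixingSubgroup_iff _ _).1 hσ x
      (IntermediateField.subset_adjoin K S ht))

end GaloisAction

section Recurrence

variable {K : Type*} [Field K] [NumberField K] {Ω : Type*} [Field Ω] [Algebra K Ω]
  [IsAlgClosure K Ω] {A : ValuationSubring Ω}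

/-- Every orbit of a rational function over a number field is recurrent, since it is contained in the
projective line over a number field, which is totally bounded. -/
theorem exists_chordal_iterate_lt (hA : HasResidueChar A) (f : RatFunc K) (α : OnePoint Ω)
    {ε : A.ValueGroup} (hε : ε ≠ 0) :
    ∃ i j : ℕ, i < j ∧ chordal A ((toMap Ω f)^[i] α) ((toMap Ω f)^[j] α) < ε := by
  have : Algebra.IsAlgebraic K Ω := IsAlgClosure.isAlgebraic
  have : IsGalois K Ω := IsAlgClosure.isGalois K Ω
  obtain ⟨E, hE, hfix⟩ := exists_finite_extension (K := K) (Set.finite_singleton α)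
  have : NumberField E := numberField_of_finite (K := K)
  have : Algebra.IsAlgebraic E Ω := Algebra.IsAlgebraic.tower_top (K := K) E
  let x : ℕ → OnePoint Ω := fun i => (toMap Ω f)^[i] α
  have hx : ∀ i, ∀ σ ∈ E.fixingSubgroup, (x i).map σ = x i := fun i σ hσ => by
    change ((toMap Ω f)^[i] α).map σ = _
    rw [← toMap_iterate_map, hfix σ hσ α rfl]
  have hmem : ∀ z : Ω, (∀ σ ∈ E.fixingSubgroup, σ z = z) → ∃ e : E, (e : Ω) = z := fun z hz => by
    have : z ∈ IntermediateField.fixedField E.fixingSubgroup := fun g => hz g g.2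
    rw [InfiniteGalois.fixedField_fixingSubgroup] at this
    exact ⟨⟨z, this⟩, rfl⟩
  -- the standard coordinates of the orbit are in a number field
  have hcoord : ∀ y : OnePoint Ω, (∀ σ ∈ E.fixingSubgroup, y.map σ = y) →
      ∃ a b : E, (a : Ω) = coordX A y ∧ (b : Ω) = coordY A y := by
    intro y hy
    induction y using OnePoint.rec with
    | infty => exact ⟨1, 0, by simp [coordX_infty], by simp [coordY_infty]⟩
    | coe z =>
      obtain ⟨e, rfl⟩ := hmem z fun σ hσ => OnePoint.coe_injective (hy σ hσ)
      by_cases hz : (e : Ω) ∈ A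
      · exact ⟨e, 1, by simp [coordX_coe_mem hz], by simp [coordY_coe_mem hz]⟩
      · exact ⟨1, e⁻¹, by simp [coordX_coe_notMem hz], by simp [coordY_coe_notMem hz]⟩
  choose a b ha hb using fun i => hcoord (x i) (hx i)
  obtain ⟨κ, hκ, col, hcol⟩ := exists_finite_coloring hA E hε
  obtain ⟨i, j, hij, h⟩ := Finite.exists_ne_map_eq_of_infinite fun i => (col (a i), col (b i))
  have main : ∀ i j, (col (a i), col (b i)) = (col (a j), col (b j)) →
      chordal A (x i) (x j) < ε := by
    intro i j h
    rw [Prod.mk.injEq] at h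
    have haA : ∀ i, algebraMap E Ω (a i) ∈ A := fun i => by
      rw [IntermediateField.algebraMap_apply, ha]
      exact (coordX A (x i)).2
    have hbA : ∀ i, algebraMap E Ω (b i) ∈ A := fun i => by
      rw [IntermediateField.algebraMap_apply, hb]
      exact (coordY A (x i)).2
    have h1 := hcol _ _ (haA i) (haA j) h.1
    have h2 := hcol _ _ (hbA i) (hbA j) h.2
    rw [chordal, ← ha, ← ha, ← hb, ← hb]
    have h3 : (a i : Ω) * b j - a j * b i =
        algebraMap E Ω (a i - a j) * b j - a j * algebraMap E Ω (b i - b j) := by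
      rw [map_sub, map_sub]
      simp only [IntermediateField.algebraMap_apply]
      ring
    rw [h3]
    refine (A.valuation.map_sub _ _).trans_lt (max_lt ?_ ?_) <;> rw [map_mul]
    · exact (mul_le_of_le_one_right' ((A.valuation_le_one_iff _).2 (hbA j))).trans_lt h1
    · exact (mul_le_of_le_one_left' ((A.valuation_le_one_iff _).2 (haA j))).trans_lt h2
  rcases lt_or_gt_of_ne hij with hlt | hlt
  · exact ⟨i, j, hlt, main i j h⟩
  · exact ⟨j, i, hlt, main j i h.symm⟩

end Recurrence

/-! ### Ramification of the preimage tree -/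

section Ramification

variable {K : Type*} [Field K] [NumberField K] {Ω : Type*} [Field Ω] [Algebra K Ω]
  [IsAlgClosure K Ω] {A : ValuationSubring Ω} {f : RatFunc K}
  {g : RatFunc (IsLocalRing.ResidueField A)}

/-- If no periodic critical disc leads to the base point, the inertia group of a finite extension
acts trivially on the tree. -/
theorem inPeriodicCriticalOrbitMod_of_isInfinitelyRamified (hA : HasResidueChar A)
    (M : IntegralModel A (toMap Ω f) (toMap (IsLocalRing.ResidueField A) g) {x | IsCritical Ω f x})
    (hpcf : IsPCF Ω f) {α : OnePoint Ω} (h : IsInfinitelyRamified f α A) :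
    InPeriodicCriticalOrbitMod A f g α := by
  by_contra hcon
  have hcl : IsAlgClosed Ω := IsAlgClosure.isAlgClosed K
  have halg : Algebra.IsAlgebraic K Ω := IsAlgClosure.isAlgebraic
  obtain ⟨T, hT, hfix⟩ := M.exists_finite_fixing_tree (α := α)
    (fun c hc hcα => hcon ⟨c, hc, hcα⟩) hpcf fun ε hε => exists_chordal_iterate_lt hA f α hε
  obtain ⟨E, hE, hET⟩ := exists_finite_extension (K := K) (hT.insert α)
  refine h ⟨E, hE, fun σ hσ => hET σ hσ α (Set.mem_insert _ _), fun σ hσE hσ => ?_⟩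
  rw [arborealRep_eq_one_iff]
  exact hfix _ (isInertial_of_mem_inertia f hσ) fun t ht => hET _ hσE t (Set.mem_insert_of_mem _ ht)

/-- A periodic critical disc which leads to the base point causes infinite ramification: the
distances of consecutive points of the backward orbit in `exists_backward_orbit` form a strictly
increasing sequence of values below one, whereas an inertia field has discrete values. -/
theorem isInfinitelyRamified_of_inPeriodicCriticalOrbitMod (hA : HasResidueChar A)
    (M : IntegralModel A (toMap Ω f) (toMap (IsLocalRing.ResidueField A) g) {x | IsCritical Ω f x})
    {α : OnePoint Ω} (hα : α ∉ periodicPts (toMap Ω f)) (h : InPeriodicCriticalOrbitMod A f g α) :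
    IsInfinitelyRamified f α A := by
  rintro ⟨E, hE, hEα, hun⟩
  have hcl : IsAlgClosed Ω := IsAlgClosure.isAlgClosed K
  have halg : Algebra.IsAlgebraic K Ω := IsAlgClosure.isAlgebraic
  obtain ⟨c, hc, hcα⟩ := h
  obtain ⟨β, hβα, hβ1, hβ⟩ := M.exists_backward_orbit hc hcα hα
  have : NumberField E := numberField_of_finite (K := K)
  have : Algebra.IsAlgebraic E Ω := Algebra.IsAlgebraic.tower_top (K := K) E
  have : IsAlgClosure E Ω := ⟨hcl, inferInstance⟩
  have hfix : ∀ σ ∈ inertia E A, ∀ n, (β n).map σ = β n := by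
    intro σ hσ n
    let τ : Ω ≃ₐ[K] Ω := σ.restrictScalars K
    have hτ : τ ∈ inertia K A := by
      have h := mem_inertia_iff.1 hσ
      rw [mem_inertia_iff]
      exact h
    have hτE : τ ∈ E.fixingSubgroup :=
      (IntermediateField.mem_fixingSubgroup_iff _ _).2 fun x hx => σ.commutes ⟨x, hx⟩
    obtain ⟨k, hk⟩ := hβα n
    exact arborealRep_eq_one_iff.1 (hun ⟨τ, hEα hτE⟩ hτE hτ) k (β n) hk
  obtain ⟨ϖ, hϖ0, hϖ1, hϖ⟩ := exists_valuation_le_of_inertia_fixed E hA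
  let x : ℕ → Ω := fun n => coordX A (β (n + 1)) * coordY A (β n) -
    coordX A (β n) * coordY A (β (n + 1))
  have hx : ∀ n, A.valuation (x n) = chordal A (β (n + 1)) (β n) := fun n => rfl
  have hxfix : ∀ n, ∀ σ ∈ inertia E A, σ (x n) = x n := by
    intro n σ hσ
    have h1 := coord_map (mem_inertia_iff.1 hσ).1 (β n)
    have h2 := coord_map (mem_inertia_iff.1 hσ).1 (β (n + 1))
    rw [hfix σ hσ] at h1 h2
    simp only [x, map_sub, map_mul, ← h1.1, ← h1.2, ← h2.1, ← h2.2]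
  have hx0 : ∀ n, x (n + 1) ≠ 0 := fun n => by
    rw [← Valuation.ne_zero_iff A.valuation, hx]
    exact (zero_le.trans_lt (hβ n)).ne'
  -- discreteness, applied to the quotients of successive terms
  have hstep : ∀ n, A.valuation (x (n + 1)) ≤ A.valuation ϖ * A.valuation (x (n + 2)) := by
    intro n
    have h0 : 0 < A.valuation (x (n + 2)) := zero_lt_iff.2 ((Valuation.ne_zero_iff _).2 (hx0 (n + 1)))
    rw [← div_le_iff₀ h0, ← map_div₀]
    refine hϖ _ (fun σ hσ => by rw [map_div₀, hxfix _ σ hσ, hxfix _ σ hσ]) ?_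
    rw [map_div₀, div_lt_one₀ h0]
    exact hβ (n + 1)
  have hpow : ∀ n, A.valuation (x 1) ≤ A.valuation ϖ ^ n := by
    intro n
    suffices h : A.valuation (x 1) ≤ A.valuation ϖ ^ n * A.valuation (x (n + 1)) from
      h.trans (mul_le_of_le_one_right' (hβ1 (n + 1)).le)
    induction n with
    | zero => simp
    | succ n ih =>
      refine ih.trans ?_
      rw [pow_succ, mul_assoc]
      exact mul_le_mul_right (hstep n) _
  obtain ⟨n, hn⟩ := exists_pow_valuation_lt K hA hϖ1 (hx0 0)
  exact absurd (hpow n) (not_le.2 hn)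

omit [NumberField K] [IsAlgClosure K Ω] in
/-- The place divides a difference in `Δ_f` exactly if some critical point is periodic modulo it. -/
theorem exists_dividesDiff_iff
    (M : IntegralModel A (toMap Ω f) (toMap (IsLocalRing.ResidueField A) g) {x | IsCritical Ω f x}) :
    (∃ δ ∈ Delta Ω f, DividesDiff A δ) ↔
      ∃ c, IsCritical Ω f c ∧ red A c ∈ periodicPts (toMap (IsLocalRing.ResidueField A) g) := by
  constructor
  · rintro ⟨_, ⟨c, hc, n, hn, rfl⟩, h⟩
    rw [dividesDiff_iff, M.red_iterate] at h
    exact ⟨c, hc, n, hn, h.symm⟩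
  · rintro ⟨c, hc, n, hn, h⟩
    refine ⟨_, ⟨c, hc, n, hn, rfl⟩, ?_⟩
    rw [dividesDiff_iff, M.red_iterate]
    exact h.symm

omit [NumberField K] [Algebra K Ω] [IsAlgClosure K Ω] in
/-- A residue disc with a center over `k` contains two finite points over `k`. -/
theorem exists_ne_red_eq (hA : HasResidueChar A) (k : Type*) [Field k] [CharZero k]
    [Algebra k Ω] {c : OnePoint Ω}
    (hc : c ∈ Set.range (OnePoint.map (algebraMap k Ω))) :
    ∃ a b : k, a ≠ b ∧ red A (algebraMap k Ω a : OnePoint Ω) = red A c ∧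
      red A (algebraMap k Ω b : OnePoint Ω) = red A c := by
  obtain ⟨n, hn0, hn⟩ := hA
  have hnk : (n : k) ≠ 0 := Nat.cast_ne_zero.2 hn0
  have hn1 : (n : k) ≠ 1 := fun h => by
    rw [← map_natCast (algebraMap k Ω), h, map_one, map_one] at hn
    exact lt_irrefl _ hn
  have hnΩ : A.valuation (n : Ω) ≠ 0 := by
    rw [Valuation.ne_zero_iff, ← map_natCast (algebraMap k Ω), map_ne_zero]
    exact hnk
  obtain ⟨c, rfl⟩ := hc
  induction c using OnePoint.rec with
  | infty =>
    have key : ∀ m : ℕ, m ≠ 0 →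
        red A (algebraMap k Ω ((n : k) ^ m)⁻¹ : OnePoint Ω) = red A OnePoint.infty := by
      intro m hm
      refine (dividesDiff_iff _ _).1 ?_
      change 1 < A.valuation (algebraMap k Ω ((n : k) ^ m)⁻¹)
      rw [map_inv₀, map_pow, map_natCast, map_inv₀, map_pow,
        one_lt_inv₀ (zero_lt_iff.2 (pow_ne_zero _ hnΩ))]
      exact pow_lt_one₀ zero_le hn hm
    refine ⟨((n : k) ^ 1)⁻¹, ((n : k) ^ 2)⁻¹, fun h => hn1 ?_, key 1 one_ne_zero, key 2 two_ne_zero⟩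
    rw [inv_inj, pow_one, sq] at h
    exact (mul_eq_left₀ hnk).1 h.symm
  | coe c =>
    refine ⟨c, c + n, fun h => hnk (left_eq_add.1 h), rfl, (dividesDiff_iff _ _).1 (Or.inl ?_)⟩
    rwa [map_add, map_natCast, add_sub_cancel_left]

/-- The residue disc of a critical point which is periodic modulo `A` contains a point `α` over the
field of definition of the critical point with infinitely ramified preimage tree: it contains at most
one periodic point. -/
theorem exists_isInfinitelyRamified (hA : HasResidueChar A)
    (M : IntegralModel A (toMap Ω f) (toMap (IsLocalRing.ResidueField A) g) {x | IsCritical Ω f x})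
    {c : OnePoint Ω} (hc : IsCritical Ω f c)
    (hper : red A c ∈ periodicPts (toMap (IsLocalRing.ResidueField A) g)) (k : Type*) [Field k]
    [CharZero k] [Algebra k Ω] (hck : c ∈ Set.range (OnePoint.map (algebraMap k Ω))) :
    ∃ α : k, IsInfinitelyRamified f (algebraMap k Ω α : OnePoint Ω) A := by
  have hcl : IsAlgClosed Ω := IsAlgClosure.isAlgClosed K
  obtain ⟨a, b, hab, ha, hb⟩ := exists_ne_red_eq hA k hck
  by_cases hpa : (algebraMap k Ω a : OnePoint Ω) ∈ periodicPts (toMap Ω f)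
  · refine ⟨b, isInfinitelyRamified_of_inPeriodicCriticalOrbitMod hA M (fun hpb => hab ?_)
      ⟨c, hc, hper, 0, hb.symm⟩⟩
    exact (algebraMap k Ω).injective (OnePoint.coe_injective
      (M.eq_of_mem_periodicPts hpa hpb (ha.trans hb.symm) (M.wval_lt_one_of_crit hc ha.symm)))
  · exact ⟨a, isInfinitelyRamified_of_inPeriodicCriticalOrbitMod hA M hpa
      ⟨c, hc, hper, 0, ha.symm⟩⟩

end Ramification

end PCFReduction

end

theorem mainTheorem5
    {K : Type*} [Field K] [NumberField K]
    {Kbar : Type*} [Field Kbar] [Algebra K Kbar] [IsAlgClosure K Kbar]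
    (f : RatFunc K) (hdeg : 1 ≤ ArborealPCF.degree f)
    (hpcf : ArborealPCF.IsPCF Kbar f)
    (𝔭 : IsDedekindDomain.HeightOneSpectrum (NumberField.RingOfIntegers K))
    (A : ValuationSubring Kbar) (hA : ArborealPCF.LiesAbove A 𝔭)
    (g : RatFunc (IsLocalRing.ResidueField A))
    (hg : ArborealPCF.IsGoodReduction A f g)
    (hheight : ArborealPCF.HasHeight g 0) :
    (ArborealPCF.Delta Kbar f).Finite ∧
    ((∃ α : Kbar, ArborealPCF.IsInfinitelyRamified f (α : OnePoint Kbar) A) ↔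
      ∃ δ ∈ ArborealPCF.Delta Kbar f, ArborealPCF.DividesDiff A δ) ∧
    ((∀ c : OnePoint Kbar, ArborealPCF.IsCritical Kbar f c →
        c ∈ Set.range (OnePoint.map (algebraMap K Kbar))) →
      ((∃ α : K, ArborealPCF.IsInfinitelyRamified f (algebraMap K Kbar α : OnePoint Kbar) A) ↔
        ∃ δ ∈ ArborealPCF.Delta Kbar f, ArborealPCF.DividesDiff A δ)) ∧
    (∀ α : OnePoint Kbar,
      (ArborealPCF.IsInfinitelyRamified f α A →
        ArborealPCF.InPeriodicCriticalOrbitMod A f g α) ∧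
      (α ∉ Function.periodicPts (ArborealPCF.toMap Kbar f) →
        ArborealPCF.InPeriodicCriticalOrbitMod A f g α →
        ArborealPCF.IsInfinitelyRamified f α A)) := by
  have hcl : IsAlgClosed Kbar := IsAlgClosure.isAlgClosed K
  have : CharZero Kbar := charZero_of_injective_algebraMap (algebraMap K Kbar).injective
  obtain ⟨M⟩ := PCFReduction.exists_integralModel (L := Kbar) hdeg hg hheight
  have hA' := PCFReduction.hasResidueChar_of_liesAbove hA
  have hram := fun α => PCFReduction.inPeriodicCriticalOrbitMod_of_isInfinitelyRamified (α := α)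
    hA' M hpcf
  refine ⟨?_, ?_, fun hK => ?_, fun α => ⟨hram α, fun hα h =>
    PCFReduction.isInfinitelyRamified_of_inPeriodicCriticalOrbitMod hA' M hα h⟩⟩
  · refine (M.finite_crit.biUnion fun c hc => (hpcf c hc).image (Prod.mk c)).subset ?_
    rintro _ ⟨c, hc, n, -, rfl⟩
    exact Set.mem_biUnion hc ⟨_, ⟨n, rfl⟩, rfl⟩
  · rw [PCFReduction.exists_dividesDiff_iff M]
    constructor
    · rintro ⟨α, hα⟩
      obtain ⟨c, hc, hper, -⟩ := hram _ hα
      exact ⟨c, hc, hper⟩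
    · rintro ⟨c, hc, hper⟩
      exact PCFReduction.exists_isInfinitelyRamified hA' M hc hper Kbar
        ⟨c, congrFun OnePoint.map_id c⟩
  · rw [PCFReduction.exists_dividesDiff_iff M]
    constructor
    · rintro ⟨α, hα⟩
      obtain ⟨c, hc, hper, -⟩ := hram _ hα
      exact ⟨c, hc, hper⟩
    · rintro ⟨c, hc, hper⟩
      exact PCFReduction.exists_isInfinitelyRamified hA' M hc hper K (hK c hc)
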